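/- **Setting.** Let $X\cdot Y=-X^0Y^0+\sum_{i=1}^3X^iY^i$ on $\mathbb R^4$, let $m\ge 0$, and let $\phi(f)=a^*(Kf)+a(K\bar f)$ be the free scalar field of mass $m$ on the bosonic Fock space over $L^2\big(\mathbb R^3,\tfrac{d^3p}{(2\pi)^3\,2\omega_p}\big)$, where $\omega_p=\sqrt{m^2+|p|^2}$ and $(Kf)(p)=\int f(x)e^{-ip\cdot x}\,d^4x$ with $p^0=\omega_p$. Let $\Omega$ be the vacuum vector, let $U(a)$, $a\in\mathbb R^4$, be the unitary translations, and put $\alpha_a(A)=U(a)AU(a)^{-1}$, so that $\alpha_a(\phi(x))=\phi(x+a)$. A cut-off function is a $\chi\in C_0^\infty(\mathbb R^4\times\mathbb R^4)$ with $\chi(0,0)=1$. For a constant real $4\times4$ matrix $\Theta$ (for instance a skew-symmetric one) the deformed (Rieffel) product is defined through its matrix elements between vectors $\phi(g_1)\cdots\phi(g_k)\Omega$ with $k\ge0$ and $g_i\in C_0^\infty(\mathbb R^4)$: $$\langle\psi',(A\times_\Theta B)\,\psi\rangle=\lim_{\epsilon\to0^+}(2\pi)^{-4}\iint\chi(\epsilon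 X,\epsilon Y)\,\langle\psi',\alpha_{\Theta X}(A)\,\alpha_Y(B)\,\psi\rangle\,e^{-iX\cdot Y}\,d^4X\,d^4Y .$$ Products of several fields are bracketed from the left. Write $$\omega_n^\Theta(\phi(f_1)\cdots\phi(f_n))=\langle\Omega,\phi(f_1)\times_\Theta\cdots\times_\Theta\phi(f_n)\,\Omega\rangle,\qquad \omega_n(\phi(f_1)\cdots\phi(f_n))=\langle\Omega,\phi(f_1)\cdots\phi(f_n)\,\Omega\rangle .$$ A quasi-free graph on the vertices $1,\dots,n$ is a directed graph in which every vertex is met by precisely one edge and every edge $e$ has source $s(e)$ smaller than its target $t(e)$; $\mathcal G_n$ is the set of these graphs. Finally, $(f\circ a)(x)=f(x+a)$. **Theorem.** Let $n\ge1$ and $f_1,\dots,f_n\in C_0^\infty(\mathbb R^4)$. For every $\Theta$ the deformed product $\phi(f_1)\times_\Theta\cdots\times_\Theta\phi(f_n)$ exists (all the limits exist), and the deformed $n$-point function $\omega_n^\Theta(\phi(f_1)\cdots\phi(f_n))$ does not depend on the cut-off function $\chi$. Moreover: 1. If $n$ is odd, then $\omega_n^\Theta(\phi(f_1)\cdots\phi(f_n))=0$.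 2. If $n$ is even, then for every cut-off function $\chi$ $$\omega_n^\Theta(\phi(f_1)\cdots\phi(f_n))=\prod_{i=1}^{n-1}\Big(\lim_{\epsilon_i\to0^+}(2\pi)^{-4}\iint dx_i\,dy_i\,\chi(\epsilon_ix_i,\epsilon_iy_i)\,e^{-ix_i\cdot y_i}\Big)\sum_{G\in\mathcal G_n}\ \prod_{e\in \mathrm{Edge}(G)}\langle\Omega,\phi(F_{s(e)})\phi(F_{t(e)})\,\Omega\rangle ,$$ where $F_N=f_N\circ\big(y_{N-1}+\Theta\sum_{k=N}^{n}x_k\big)$ with $y_0=0$ and $x_n=0$. The integrals and limits are iterated, the one with index $1$ being taken first and the one with index $n-1$ last. (In this sense the deformed state is quasi-free.) 3. As $\Theta\to0$, $\ \omega_n^\Theta(\phi(f_1)\cdots\phi(f_n))\to\omega_n(\phi(f_1)\cdots\phi(f_n))$. -/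

import Mathlib

open MeasureTheory Filter Topology Matrix
open scoped ContDiff ComplexConjugate

noncomputable section

namespace DeformedQFT

/-! ### Minkowski space, test functions and cut-offs -/

/-- Minkowski space `ℝ⁴`, coordinates `(X⁰, X¹, X², X³)`. -/
abbrev Spacetime : Type := Fin 4 → ℝ

/-- The Minkowski product `X · Y = - X⁰ Y⁰ + X¹ Y¹ + X² Y² + X³ Y³`. -/
def mink (X Y : Spacetime) : ℝ := -(X 0 * Y 0) + X 1 * Y 1 + X 2 * Y 2 + X 3 * Y 3

/-- Test functions: elements of `C₀^∞(ℝ⁴)` (complex valued, so in particular the real ones). -/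
def IsTestFunction (f : Spacetime → ℂ) : Prop := ContDiff ℝ ∞ f ∧ HasCompactSupport f

/-- Cut-off functions: `χ ∈ C₀^∞(ℝ⁴ × ℝ⁴)` with `χ(0, 0) = 1`. -/
def IsCutoff (χ : Spacetime × Spacetime → ℂ) : Prop :=
  ContDiff ℝ ∞ χ ∧ HasCompactSupport χ ∧ χ (0, 0) = 1

/-- The translated test function `(f ∘ a)(x) = f (x + a)`. -/
def shiftFn (f : Spacetime → ℂ) (a : Spacetime) : Spacetime → ℂ := fun x => f (x + a)

/-! ### Bosonic Fock space of the free scalar field of mass `m`, in momentum space -/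

/-- Spatial momentum space. -/
abbrev Momentum : Type := Fin 3 → ℝ

/-- The relativistic energy `ω_p = √(m² + |p|²)`. -/
def energy (m : ℝ) (p : Momentum) : ℝ := Real.sqrt (m ^ 2 + (p 0 ^ 2 + p 1 ^ 2 + p 2 ^ 2))

/-- The four-momentum `(ω_p, p)` on the forward mass shell. -/
def onShell (m : ℝ) (p : Momentum) : Spacetime := ![energy m p, p 0, p 1, p 2]

/-- The Lorentz invariant measure `d³p / ((2π)³ 2 ω_p)` on the forward mass shell. -/
def shellMeasure (m : ℝ) : Measure Momentum :=
  volume.withDensity fun p => ENNReal.ofReal ((2 * Real.pi) ^ 3 * (2 * energy m p))⁻¹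

/-- Fock space vectors, given by their momentum space wave functions: `ψ k` is the `k`-particle
component. -/
abbrev Fock : Type := (k : ℕ) → (Fin k → Momentum) → ℂ

/-- The Fock space scalar product
`⟨ψ', ψ⟩ = ∑ₖ ∫ conj (ψ'ₖ(p₁, …, pₖ)) ψₖ(p₁, …, pₖ) dμ(p₁) ⋯ dμ(pₖ)`. -/
def fockInner (m : ℝ) (ψ' ψ : Fock) : ℂ :=
  ∑' k : ℕ, ∫ p, conj (ψ' k p) * ψ k p ∂(Measure.pi fun _ : Fin k => shellMeasure m)

/-- The Minkowski vacuum `Ω = (1, 0, 0, …)`. -/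
def vacuum : Fock
  | 0 => fun _ => 1
  | _ + 1 => fun _ => 0

/-- The creation operator:
`(a*(u) ψ)ₖ(p₁, …, pₖ) = k^{-1/2} ∑ⱼ u(pⱼ) ψₖ₋₁(p₁, …, p̂ⱼ, …, pₖ)`. -/
def create (u : Momentum → ℂ) (ψ : Fock) : Fock
  | 0 => fun _ => 0
  | k + 1 => fun p =>
      ((Real.sqrt ((k : ℝ) + 1))⁻¹ : ℝ) * ∑ j : Fin (k + 1), u (p j) * ψ k fun i => p (j.succAbove i)

/-- The annihilation operator:
`(a(u) ψ)ₖ(p₁, …, pₖ) = (k+1)^{1/2} ∫ conj (u(q)) ψₖ₊₁(q, p₁, …, pₖ) dμ(q)`. -/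
def annihilate (m : ℝ) (u : Momentum → ℂ) (ψ : Fock) : Fock := fun k p =>
  (Real.sqrt ((k : ℝ) + 1) : ℝ) * ∫ q, conj (u q) * ψ (k + 1) (Fin.cons q p) ∂(shellMeasure m)

/-- The one-particle wave function of a test function, `(K f)(p) = ∫ f(x) e^{-i p·x} d⁴x` with `p`
on the mass shell. -/
def oneParticle (m : ℝ) (f : Spacetime → ℂ) (p : Momentum) : ℂ :=
  ∫ x : Spacetime, f x * Complex.exp (-Complex.I * (mink (onShell m p) x : ℝ))

/-- The free scalar (Klein-Gordon) field smeared with `f`: `φ(f) = a*(K f) + a(K (conj f))`, i.e.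
`φ(f) = ∫ f(x) φ(x) d⁴x` with `φ(x) = ∫ (a(p) e^{i p·x} + a*(p) e^{-i p·x}) dμ(p)`. It is complex
linear in `f`; for real `f` it is `a*(K f) + a(K f)`. -/
def field (m : ℝ) (f : Spacetime → ℂ) (ψ : Fock) : Fock :=
  create (oneParticle m f) ψ + annihilate m (oneParticle m fun x => conj (f x)) ψ

/-- The unitary translations `U(a) = e^{-i a·P}`; one has `U(a) Ω = Ω` and
`U(a) φ(x) U(a)⁻¹ = φ(x + a)`. -/
def translation (m : ℝ) (a : Spacetime) (ψ : Fock) : Fock := fun k p =>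
  Complex.exp (-Complex.I * (mink a (∑ j, onShell m (p j)) : ℝ)) * ψ k p

/-- The translation action on operators, `α_a(B) = U(a) B U(a)⁻¹`, where `U(a)⁻¹ = U(-a)`. -/
def translateOp (m : ℝ) (a : Spacetime) (B : Fock → Fock) : Fock → Fock := fun ψ =>
  translation m a (B (translation m (-a) ψ))

/-- The undeformed `n`-point function `⟨Ω, φ(f₁) ⋯ φ(fₙ) Ω⟩`. -/
def nPoint (m : ℝ) (l : List (Spacetime → ℂ)) : ℂ :=
  fockInner m vacuum (l.foldr (field m) vacuum)

/-- The vectors `φ(g₁) ⋯ φ(gₖ) Ω` (`k ≥ 0`, `gᵢ` test functions), which span the dense domain on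
which the field operators act. -/
inductive FieldVector (m : ℝ) : Fock → Prop
  | vacuum : FieldVector m DeformedQFT.vacuum
  | field (g : Spacetime → ℂ) (hg : IsTestFunction g) (ψ : Fock) (hψ : FieldVector m ψ) :
      FieldVector m (DeformedQFT.field m g ψ)

/-! ### Oscillatory integrals and the Rieffel product -/

/-- The regularized oscillatory integral
`lim_{ε → 0+} (2π)⁻⁴ ∬ χ(εX, εY) F(X, Y) e^{-i X·Y} d⁴X d⁴Y` exists and equals `L`. -/
def HasOscillatoryIntegral (χ : Spacetime × Spacetime → ℂ) (F : Spacetime × Spacetime → ℂ)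
    (L : ℂ) : Prop :=
  (∀ ε : ℝ, 0 < ε → Integrable fun z : Spacetime × Spacetime =>
      χ (ε • z) * F z * Complex.exp (-Complex.I * (mink z.1 z.2 : ℝ))) ∧
  Tendsto (fun ε : ℝ => (((2 * Real.pi) ^ 4)⁻¹ : ℝ) * ∫ z : Spacetime × Spacetime,
      χ (ε • z) * F z * Complex.exp (-Complex.I * (mink z.1 z.2 : ℝ))) (𝓝[>] 0) (𝓝 L)

/-- The iterated oscillatory integral
`∏ᵢ₌₁ⁿ lim_{εᵢ → 0} (2π)⁻⁴ ∬ dxᵢ dyᵢ χ(εᵢxᵢ, εᵢyᵢ) e^{-i xᵢ·yᵢ} F((x₁, y₁), …, (xₙ, yₙ))`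
exists and equals `L`. The pair `(x₁, y₁)` is integrated first, `(xₙ, yₙ)` last. -/
def HasIteratedOscillatoryIntegral (χ : Spacetime × Spacetime → ℂ) :
    (n : ℕ) → ((Fin n → Spacetime × Spacetime) → ℂ) → ℂ → Prop
  | 0, F, L => F Fin.elim0 = L
  | n + 1, F, L => ∃ G : Spacetime × Spacetime → ℂ,
      (∀ z, HasIteratedOscillatoryIntegral χ n
        (fun w => F (Fin.snoc (α := fun _ => Spacetime × Spacetime) w z)) (G z)) ∧
      HasOscillatoryIntegral χ G L

/-- `T` is the Rieffel product `S ×_Θ B` of `S` with the operator `B`. Here `S` and `T` are given by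
their matrix elements between field vectors, `S ψ' ψ = ⟨ψ', S ψ⟩`, so that
`⟨ψ', (S ×_Θ B) ψ⟩ = lim_{ε → 0} (2π)⁻⁴ ∬ χ(εX, εY) ⟨ψ', α_{ΘX}(S) α_Y(B) ψ⟩ e^{-i X·Y} d⁴X d⁴Y`
with `⟨ψ', α_a(S) ψ⟩ = ⟨U(a)⁻¹ ψ', S U(a)⁻¹ ψ⟩`. -/
def IsRieffelProduct (m : ℝ) (χ : Spacetime × Spacetime → ℂ) (Θ : Matrix (Fin 4) (Fin 4) ℝ)
    (S : Fock → Fock → ℂ) (B : Fock → Fock) (T : Fock → Fock → ℂ) : Prop :=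
  ∀ ψ' ψ : Fock, FieldVector m ψ' → FieldVector m ψ →
    HasOscillatoryIntegral χ
      (fun z => S (translation m (-(Θ *ᵥ z.1)) ψ')
        (translation m (-(Θ *ᵥ z.1)) (translateOp m z.2 B ψ)))
      (T ψ' ψ)

/-- `T` is the deformed product `(⋯(φ(f₁) ×_Θ φ(f₂)) ×_Θ ⋯) ×_Θ φ(fₙ₊₁)` of field operators, given
by its matrix elements `T ψ' ψ` between field vectors. These are unique, being limits. -/
def IsDeformedFieldProduct (m : ℝ) (χ : Spacetime × Spacetime → ℂ)
    (Θ : Matrix (Fin 4) (Fin 4) ℝ) :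
    (n : ℕ) → (Fin (n + 1) → Spacetime → ℂ) → (Fock → Fock → ℂ) → Prop
  | 0, f, T => ∀ ψ' ψ : Fock, FieldVector m ψ' → FieldVector m ψ →
      T ψ' ψ = fockInner m ψ' (field m (f 0) ψ)
  | n + 1, f, T => ∃ S : Fock → Fock → ℂ,
      IsDeformedFieldProduct m χ Θ n (fun i => f i.castSucc) S ∧
      IsRieffelProduct m χ Θ S (field m (f (Fin.last (n + 1)))) T

/-- The deformed product of the fields `φ(f₁), …, φ(fₙ₊₁)` exists and the deformed
`(n+1)`-point function `⟨Ω, φ(f₁) ×_Θ ⋯ ×_Θ φ(fₙ₊₁) Ω⟩` equals `w`. -/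
def IsDeformedNPoint (m : ℝ) (χ : Spacetime × Spacetime → ℂ) (Θ : Matrix (Fin 4) (Fin 4) ℝ)
    (n : ℕ) (f : Fin (n + 1) → Spacetime → ℂ) (w : ℂ) : Prop :=
  ∃ T : Fock → Fock → ℂ, IsDeformedFieldProduct m χ Θ n f T ∧ T vacuum vacuum = w

/-! ### Quasi-free graphs -/

/-- `G`, a set of directed edges `(s(e), t(e))` on `N` labelled vertices, is a quasi-free graph: each
edge has `s(e) < t(e)` and each vertex is met by precisely one edge. -/
def IsQuasiFreeGraph {N : ℕ} (G : Finset (Fin N × Fin N)) : Prop :=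
  (∀ e ∈ G, e.1 < e.2) ∧ ∀ v : Fin N, ∃! e, e ∈ G ∧ (e.1 = v ∨ e.2 = v)

open Classical in
/-- The finite set `𝒢_N` of quasi-free graphs on `N` vertices. -/
def quasiFreeGraphs (N : ℕ) : Finset (Finset (Fin N × Fin N)) :=
  Finset.univ.filter fun G => IsQuasiFreeGraph G

/-- The shifted test functions `F_N = f_N ∘ (y_{N-1} + Θ ∑_{k ≥ N} x_k)`, `N = 1, …, n+1`, where
`z = ((x₁, y₁), …, (xₙ, yₙ))`, `y₀ = 0` and `xₙ₊₁ = 0`. Indices of `f` and `z` start from `0` in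
the code. -/
def shifted (Θ : Matrix (Fin 4) (Fin 4) ℝ) {n : ℕ} (f : Fin (n + 1) → Spacetime → ℂ)
    (z : Fin n → Spacetime × Spacetime) (i : Fin (n + 1)) : Spacetime → ℂ :=
  shiftFn (f i)
    (Fin.cases (motive := fun _ => Spacetime) 0 (fun j => (z j).2) i
      + Θ *ᵥ ∑ k : Fin n with i ≤ k.castSucc, (z k).1)

/-- The sum over quasi-free graphs `∑_{G ∈ 𝒢} ∏_{e ∈ G} ⟨Ω, φ(F_{s(e)}) φ(F_{t(e)}) Ω⟩`. -/
def wickSum (m : ℝ) {N : ℕ} (F : Fin N → Spacetime → ℂ) : ℂ :=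
  ∑ G ∈ quasiFreeGraphs N, ∏ e ∈ G, nPoint m [F e.1, F e.2]

end DeformedQFT

end

/-!
The `n`-point function of shifted fields is, by Wick's theorem, a sum over quasi-free graphs `G` of
Fourier integrals: if the edge `e` of `G` carries the on-shell momentum `q e`, then
`⟨Ω, φ(f₁ ∘ a₁) ⋯ φ(f_N ∘ a_N) Ω⟩ = ∑_G ∫ h_G(q) e^{i ∑ᵢ κᵢ(q)·aᵢ} dμ(q)`
with an integrable kernel `h_G`, where `κᵢ(q)` is the momentum of the edge at the vertex `i`, with a
positive sign at targets and a negative sign at sources. This is `isKernel_wickKernel`; the sum of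
all `κᵢ` vanishes.

All matrix elements between field vectors are of this form: translations of operators become shifts
of test functions (`translation_field`), and a bra vector can be moved to the other side by the
hermiticity of the field (`fockInner_fieldVec`). So every oscillatory integral in question has an
integrand `∫ h(p) e^{i (u(p)·X + v(p)·Y)} dν(p)` with integrable `h`, and such an oscillatory
integral exists, for any cut-off function, with the value `∫ h(p) e^{i u(p)·v(p)} dν(p)`
(`hasOscillatoryIntegral_fourier`). The reason is that the regularized integral of a single plane
wave is bounded uniformly in `u`, `v` and `ε`: the `Y`-integral is a partial Fourier transform of
the cut-off function, which concentrates the `X`-integral near `X = v` (`integral_cutoff_planeWave`).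

By induction on the number of fields, the deformed product inserts the phase `e^{i ∑_{i<j} κᵢ·Θκⱼ}`
under the integral (`IsDeformedFieldProduct.hasTwistedElements`), whatever the cut-off function is.
The iterated oscillatory integral of the graph expansion produces the same phase
(`hasIteratedOscillatoryIntegral_wickSum`). There are no quasi-free graphs on an odd number of
vertices, and the limit `Θ → 0` is a case of dominated convergence.
-/

noncomputable section

namespace DeformedQFT

/-! ### The Minkowski product as a bilinear form -/

/-- The Minkowski product as a continuous bilinear form. -/
def minkCLM : Spacetime →L[ℝ] Spacetime →L[ℝ] ℝ :=
  -(ContinuousLinearMap.proj (R := ℝ) (φ := fun _ : Fin 4 => ℝ) 0).smulRight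
      (ContinuousLinearMap.proj (R := ℝ) (φ := fun _ : Fin 4 => ℝ) 0)
    + (ContinuousLinearMap.proj (R := ℝ) (φ := fun _ : Fin 4 => ℝ) 1).smulRight
      (ContinuousLinearMap.proj (R := ℝ) (φ := fun _ : Fin 4 => ℝ) 1)
    + (ContinuousLinearMap.proj (R := ℝ) (φ := fun _ : Fin 4 => ℝ) 2).smulRight
      (ContinuousLinearMap.proj (R := ℝ) (φ := fun _ : Fin 4 => ℝ) 2)
    + (ContinuousLinearMap.proj (R := ℝ) (φ := fun _ : Fin 4 => ℝ) 3).smulRight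
      (ContinuousLinearMap.proj (R := ℝ) (φ := fun _ : Fin 4 => ℝ) 3)

lemma minkCLM_apply (X Y : Spacetime) : minkCLM X Y = mink X Y := by
  simp [minkCLM, mink]

lemma mink_comm (X Y : Spacetime) : mink X Y = mink Y X := by
  simp only [mink]; ring

lemma mink_add_left (X X' Y : Spacetime) : mink (X + X') Y = mink X Y + mink X' Y := by
  simp only [← minkCLM_apply, map_add, _root_.add_apply]

lemma mink_add_right (X Y Y' : Spacetime) : mink X (Y + Y') = mink X Y + mink X Y' := by
  simp only [← minkCLM_apply, map_add]

lemma mink_sub_left (X X' Y : Spacetime) : mink (X - X') Y = mink X Y - mink X' Y := by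
  simp only [← minkCLM_apply, map_sub, _root_.sub_apply]

lemma mink_sub_right (X Y Y' : Spacetime) : mink X (Y - Y') = mink X Y - mink X Y' := by
  simp only [← minkCLM_apply, map_sub]

lemma mink_neg_left (X Y : Spacetime) : mink (-X) Y = -mink X Y := by
  simp only [← minkCLM_apply, map_neg, _root_.neg_apply]

lemma mink_neg_right (X Y : Spacetime) : mink X (-Y) = -mink X Y := by
  simp only [← minkCLM_apply, map_neg]

lemma mink_smul_left (c : ℝ) (X Y : Spacetime) : mink (c • X) Y = c * mink X Y := by
  simp only [← minkCLM_apply, map_smul, _root_.smul_apply, smul_eq_mul]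

lemma mink_smul_right (c : ℝ) (X Y : Spacetime) : mink X (c • Y) = c * mink X Y := by
  simp only [← minkCLM_apply, map_smul, smul_eq_mul]

lemma mink_zero_left (Y : Spacetime) : mink 0 Y = 0 := by simp [← minkCLM_apply]

lemma mink_zero_right (X : Spacetime) : mink X 0 = 0 := by simp [← minkCLM_apply]

lemma mink_sum_left {ι : Type*} (s : Finset ι) (X : ι → Spacetime) (Y : Spacetime) :
    mink (∑ i ∈ s, X i) Y = ∑ i ∈ s, mink (X i) Y := by
  simp only [← minkCLM_apply, map_sum, _root_.sum_apply]

lemma mink_sum_right {ι : Type*} (s : Finset ι) (X : Spacetime) (Y : ι → Spacetime) :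
    mink X (∑ i ∈ s, Y i) = ∑ i ∈ s, mink X (Y i) := by
  simp only [← minkCLM_apply, map_sum]

lemma continuous_mink : Continuous fun z : Spacetime × Spacetime => mink z.1 z.2 := by
  unfold mink; fun_prop

@[fun_prop]
lemma Continuous.mink {α : Type*} [TopologicalSpace α] {f g : α → Spacetime}
    (hf : Continuous f) (hg : Continuous g) : Continuous fun x => mink (f x) (g x) :=
  continuous_mink.comp (hf.prodMk hg)

@[fun_prop]
lemma Measurable.mink {α : Type*} [MeasurableSpace α] {f g : α → Spacetime}
    (hf : Measurable f) (hg : Measurable g) : Measurable fun x => mink (f x) (g x) :=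
  continuous_mink.measurable.comp (hf.prodMk hg)

/-- The phase factor `e^{i t}`. -/
def phase (t : ℝ) : ℂ := Complex.exp (Complex.I * t)

lemma phase_add (s t : ℝ) : phase (s + t) = phase s * phase t := by
  simp [phase, mul_add, Complex.exp_add]

lemma phase_zero : phase 0 = 1 := by simp [phase]

lemma norm_phase (t : ℝ) : ‖phase t‖ = 1 := by
  rw [phase, mul_comm]; exact Complex.norm_exp_ofReal_mul_I t

lemma conj_phase (t : ℝ) : conj (phase t) = phase (-t) := by
  simp [phase, ← Complex.exp_conj]

lemma exp_neg_I_mul (t : ℝ) : Complex.exp (-Complex.I * (t : ℝ)) = phase (-t) := by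
  simp [phase]

@[fun_prop]
lemma continuous_phase : Continuous phase := by unfold phase; fun_prop

@[fun_prop]
lemma measurable_phase : Measurable phase := continuous_phase.measurable

lemma Integrable.mul_phase {P : Type*} [MeasurableSpace P] {ν : Measure P} {h : P → ℂ}
    (hh : Integrable h ν) {t : P → ℝ} (ht : Measurable t) :
    Integrable (fun p => h p * phase (t p)) ν := by
  refine hh.mul_bdd (c := 1) (by fun_prop) (ae_of_all _ fun p => ?_)
  rw [norm_phase]

/-! ### The Fourier transform with respect to the Minkowski product -/

/-- The Fourier transform `T ↦ ∫ g(x) e^{-i T·x} d⁴x`. -/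
def minkFT (g : Spacetime → ℂ) (T : Spacetime) : ℂ := ∫ x, g x * phase (-mink T x)

lemma integrable_iteratedFDeriv {g : Spacetime → ℂ} (hg : ContDiff ℝ ∞ g)
    (hc : HasCompactSupport g) (j : ℕ) : Integrable fun v => ‖iteratedFDeriv ℝ j g v‖ :=
  (Continuous.integrable_of_hasCompactSupport
    (hg.continuous_iteratedFDeriv (m := j) (by exact_mod_cast le_top)) (hc.iteratedFDeriv j)).norm

/-- Repeated integration by parts: the decay of the Fourier transform of a test function, with a
constant that involves only the `L¹` norms of the derivatives. -/
lemma norm_pow_mul_minkFT_le {g : Spacetime → ℂ} (hg : ContDiff ℝ ∞ g)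
    (hc : HasCompactSupport g) (n : ℕ) (T : Spacetime) :
    ‖T‖ ^ n * ‖minkFT g T‖ ≤
      (4 * Real.pi) ^ n * ∑ j ∈ Finset.range (n + 1), ∫ v, ‖iteratedFDeriv ℝ j g v‖ := by
  set L : Spacetime →L[ℝ] Spacetime →L[ℝ] ℝ := (2 * Real.pi)⁻¹ • minkCLM with hL
  have hpi : 0 < 2 * Real.pi := by positivity
  have hLa : ∀ v w, L v w = (2 * Real.pi)⁻¹ * mink v w := fun v w => by
    simp [hL, minkCLM_apply]
  have hF : VectorFourier.fourierIntegral Real.fourierChar volume L.toLinearMap₁₂ g T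
      = minkFT g T := by
    simp only [VectorFourier.fourierIntegral, minkFT]
    refine integral_congr_ae (ae_of_all _ fun v => ?_)
    have : L.toLinearMap₁₂ v T = (2 * Real.pi)⁻¹ * mink v T := hLa v T
    simp only [this, Circle.smul_def, Real.fourierChar_apply, smul_eq_mul, phase, mink_comm T v]
    rw [mul_comm]
    congr 2
    push_cast
    field_simp
  -- differentiation in the direction of the largest component of `T` gives the power of `‖T‖`
  obtain ⟨i, hi⟩ : ∃ i, ‖T‖ = |T i| := by
    obtain ⟨i, -, hi⟩ := Finset.exists_max_image Finset.univ (fun i => |T i|) ⟨0, Finset.mem_univ _⟩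
    exact ⟨i, le_antisymm ((pi_norm_le_iff_of_nonneg (abs_nonneg _)).2
      fun j => by simpa using hi j (Finset.mem_univ _)) (norm_le_pi_norm T i)⟩
  have hLi : |L (Pi.single i 1) T| = (2 * Real.pi)⁻¹ * ‖T‖ := by
    rw [hLa, hi, abs_mul, abs_of_pos (inv_pos.2 hpi)]
    congr 1
    fin_cases i <;> simp [mink]
  have key := VectorFourier.pow_mul_norm_iteratedFDeriv_fourierIntegral_le (μ := volume) L
    (K := 0) (N := ⊤) (f := g) hg
    (fun k j hk _ => by
      obtain rfl : k = 0 := Nat.le_zero.1 (by exact_mod_cast hk)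
      simpa using integrable_iteratedFDeriv hg hc j)
    (k := 0) (n := n) le_rfl le_top (Pi.single i 1) T
  rw [norm_iteratedFDeriv_zero, hF, hLi] at key
  have h1 : ‖(Pi.single i 1 : Spacetime)‖ = 1 :=
    (Pi.norm_single (G := fun _ : Fin 4 => ℝ) 1).trans norm_one
  rw [h1] at key
  simp only [one_pow, pow_zero, Nat.cast_zero, mul_zero, zero_add, one_mul, Finset.range_one,
    Finset.singleton_product, Finset.sum_map, Function.Embedding.coeFn_mk] at key
  have e : (4 * Real.pi) ^ n = (2 * Real.pi) ^ n * 2 ^ n := by rw [← mul_pow]; ring_nf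
  calc ‖T‖ ^ n * ‖minkFT g T‖
      = (2 * Real.pi) ^ n * (((2 * Real.pi)⁻¹ * ‖T‖) ^ n * ‖minkFT g T‖) := by
        rw [mul_pow _ ‖T‖, inv_pow, ← mul_assoc, ← mul_assoc,
          mul_inv_cancel₀ (pow_ne_zero n hpi.ne'), one_mul]
    _ ≤ _ := by
        rw [e, mul_assoc]
        gcongr

lemma minkFT_bound {g : Spacetime → ℂ} (hg : ContDiff ℝ ∞ g) (hc : HasCompactSupport g) (n : ℕ)
    {B : ℝ} (hB : ∀ j ≤ n, ∫ v, ‖iteratedFDeriv ℝ j g v‖ ≤ B) (T : Spacetime) :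
    ‖minkFT g T‖ ≤ (2 ^ n * (1 + (4 * Real.pi) ^ n * (n + 1)) * B) * (1 + ‖T‖) ^ (-(n : ℝ)) := by
  have h0 := norm_pow_mul_minkFT_le hg hc 0 T
  have hn := norm_pow_mul_minkFT_le hg hc n T
  have hs : ∑ j ∈ Finset.range (n + 1), ∫ v, ‖iteratedFDeriv ℝ j g v‖ ≤ (n + 1) * B := by
    refine (Finset.sum_le_card_nsmul _ _ B fun j hj => hB j ?_).trans (by simp)
    simpa [Nat.lt_succ_iff] using hj
  simp only [pow_zero, one_mul, zero_add, Finset.range_one, Finset.sum_singleton] at h0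
  have h0' := h0.trans (hB 0 (Nat.zero_le _))
  rw [Real.rpow_neg (by positivity), Real.rpow_natCast, ← div_eq_mul_inv,
    le_div_iff₀ (by positivity)]
  have hadd : (1 + ‖T‖) ^ n ≤ 2 ^ n * (1 + ‖T‖ ^ n) := by
    calc (1 + ‖T‖) ^ n ≤ (2 * max 1 ‖T‖) ^ n := by
          gcongr
          have := le_max_left 1 ‖T‖
          have := le_max_right 1 ‖T‖
          linarith
      _ = 2 ^ n * max 1 ‖T‖ ^ n := mul_pow _ _ _
      _ ≤ _ := by
          gcongr
          rcases le_total 1 ‖T‖ with h | h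
          · rw [max_eq_right h]; linarith
          · rw [max_eq_left h, one_pow]; linarith [pow_nonneg (norm_nonneg T) n]
  calc ‖minkFT g T‖ * (1 + ‖T‖) ^ n ≤ ‖minkFT g T‖ * (2 ^ n * (1 + ‖T‖ ^ n)) := by gcongr
    _ = 2 ^ n * (‖minkFT g T‖ + ‖T‖ ^ n * ‖minkFT g T‖) := by ring
    _ ≤ 2 ^ n * (B + (4 * Real.pi) ^ n * ((n + 1) * B)) := by
        refine mul_le_mul_of_nonneg_left (add_le_add h0' ?_) (by positivity)
        exact hn.trans (mul_le_mul_of_nonneg_left hs (by positivity))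
    _ = _ := by ring

lemma continuous_minkFT {g : Spacetime → ℂ} (hg : Integrable g) : Continuous (minkFT g) := by
  refine continuous_of_dominated (bound := fun x => ‖g x‖) (fun T => ?_) (fun T => ?_) hg.norm ?_
  · exact (Integrable.mul_phase hg (by fun_prop)).aestronglyMeasurable
  · exact ae_of_all _ fun x => by simp [norm_phase]
  · exact ae_of_all _ fun x => by fun_prop

/-- Reflection of time, as an isometry of Euclidean space; it turns the Minkowski product into the
Euclidean one. -/
def timeReflection : EuclideanSpace ℝ (Fin 4) ≃ₗᵢ[ℝ] EuclideanSpace ℝ (Fin 4) :=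
  LinearIsometryEquiv.piLpCongrRight 2 fun i : Fin 4 =>
    if i = 0 then LinearIsometryEquiv.neg ℝ else LinearIsometryEquiv.refl ℝ ℝ

lemma inner_timeReflection (x y : EuclideanSpace ℝ (Fin 4)) :
    inner ℝ x (timeReflection y) = mink (WithLp.ofLp y) (WithLp.ofLp x) := by
  simp [timeReflection, mink, PiLp.inner_apply, Fin.sum_univ_four]

/-- Fourier inversion at the origin. -/
lemma integral_minkFT {g : Spacetime → ℂ} (hg : Continuous g) (hi : Integrable g)
    (hF : Integrable (minkFT g)) :
    ∫ T, minkFT g T = ((2 * Real.pi) ^ 4 : ℝ) * g 0 := by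
  set e := MeasurableEquiv.toLp 2 (Fin 4 → ℝ)
  have he : MeasurePreserving e.symm := EuclideanSpace.volume_preserving_symm_measurableEquiv_toLp _
  set g' : EuclideanSpace ℝ (Fin 4) → ℂ := fun x => g (e.symm x) with hg'
  have hπ : (2 * Real.pi) ≠ 0 := by positivity
  -- `𝓕 g'` is the transform `minkFT g` after a rescaling and a reflection of time.
  have hFT : ∀ w, FourierTransform.fourier g' (timeReflection ((2 * Real.pi)⁻¹ • w))
      = minkFT g (e.symm w) := by
    intro w
    rw [Real.fourier_eq', minkFT, ← he.integral_comp' (fun x => g x * phase (-mink (e.symm w) x))]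
    refine integral_congr_ae (ae_of_all _ fun v => ?_)
    simp only [inner_timeReflection, phase, smul_eq_mul, hg']
    rw [mul_comm]
    congr 2
    have : mink (((2 * Real.pi)⁻¹ • w).ofLp) v.ofLp
        = (2 * Real.pi)⁻¹ * mink (e.symm w) (e.symm v) := mink_smul_left _ _ _
    rw [this]
    push_cast
    have h2 : (Real.pi : ℂ) ≠ 0 := by exact_mod_cast Real.pi_ne_zero
    field_simp
  have hgi : Integrable g' := (he.integrable_comp_emb e.symm.measurableEmbedding).2 hi
  have hcomp : Integrable fun w =>
      FourierTransform.fourier g' (timeReflection ((2 * Real.pi)⁻¹ • w)) := by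
    simp only [hFT]
    exact (he.integrable_comp_emb e.symm.measurableEmbedding).2 hF
  have h1 : Integrable fun w => FourierTransform.fourier g' (timeReflection w) :=
    (integrable_comp_smul_iff volume _ (inv_ne_zero hπ)).1 hcomp
  have h2 : Integrable (FourierTransform.fourier g') :=
    (timeReflection.measurePreserving.integrable_comp_emb
      timeReflection.toHomeomorph.measurableEmbedding).1 h1
  have hc : Continuous g' := hg.comp (PiLp.continuous_ofLp 2 _)
  have hinv := hgi.fourierInv_fourier_eq h2 (v := 0) hc.continuousAt
  rw [Real.fourierInv_eq'] at hinv
  simp only [inner_zero_right, mul_zero, Complex.ofReal_zero, zero_mul, Complex.exp_zero,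
    one_smul] at hinv
  have h3 : ∫ T, minkFT g T
      = ∫ w, FourierTransform.fourier g' (timeReflection ((2 * Real.pi)⁻¹ • w)) := by
    simp only [hFT]
    exact (he.integral_comp' (minkFT g)).symm
  rw [h3, Measure.integral_comp_smul volume
      (fun w => FourierTransform.fourier g' (timeReflection w)),
    timeReflection.measurePreserving.integral_comp
      timeReflection.toHomeomorph.measurableEmbedding (FourierTransform.fourier g'), hinv]
  have : g' 0 = g 0 := rfl
  rw [this, Complex.real_smul]
  congr 2
  rw [finrank_euclideanSpace, Fintype.card_fin, inv_pow, inv_inv, abs_of_pos (by positivity)]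

/-! ### Oscillatory integrals of Fourier integrals -/

lemma norm_iteratedFDeriv_slice_le {χ : Spacetime × Spacetime → ℂ} (hχ : ContDiff ℝ ∞ χ)
    (X Y : Spacetime) (j : ℕ) :
    ‖iteratedFDeriv ℝ j (fun Y => χ (X, Y)) Y‖ ≤ ‖iteratedFDeriv ℝ j χ (X, Y)‖ := by
  set ψ : Spacetime × Spacetime → ℂ := fun w => χ ((X, 0) + w) with hψ
  have hψc : ContDiff ℝ ∞ ψ := hχ.comp (contDiff_const.add contDiff_id)
  have h1 : (fun Y => χ (X, Y)) = ψ ∘ ContinuousLinearMap.inr ℝ Spacetime Spacetime := by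
    ext Y; simp [hψ]
  rw [h1, ContinuousLinearMap.iteratedFDeriv_comp_right _ hψc Y (i := j)
    (by exact_mod_cast le_top)]
  refine (ContinuousMultilinearMap.norm_compContinuousLinearMap_le _ _).trans ?_
  rw [hψ, iteratedFDeriv_comp_add_left]
  have h2 : (X, (0 : Spacetime)) + ContinuousLinearMap.inr ℝ Spacetime Spacetime Y = (X, Y) := by
    simp
  rw [h2]
  refine mul_le_of_le_one_right (norm_nonneg _) (Finset.prod_le_one (fun _ _ => norm_nonneg _)
    fun _ _ => ContinuousLinearMap.norm_inr_le_one ℝ _ _)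

lemma hasCompactSupport_slice {χ : Spacetime × Spacetime → ℂ} (hχ : HasCompactSupport χ)
    (X : Spacetime) : HasCompactSupport fun Y => χ (X, Y) :=
  hχ.comp_isClosedEmbedding (Topology.IsClosedEmbedding.of_continuous_injective_isClosedMap
    (by fun_prop) (fun _ _ h => (Prod.ext_iff.1 h).2) (isClosedMap_prodMk_left X))

lemma integrable_one_add_norm_five : Integrable fun T : Spacetime => (1 + ‖T‖) ^ (-(5 : ℝ)) :=
  integrable_one_add_norm (by simp; norm_num)

/-- The partial Fourier transform of a cut-off function in its second argument is integrable,
uniformly in the first argument. -/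
lemma exists_bound_minkFT_slice {χ : Spacetime × Spacetime → ℂ} (hχ : ContDiff ℝ ∞ χ)
    (hc : HasCompactSupport χ) :
    ∃ C : ℝ, ∀ X T, ‖minkFT (fun Y => χ (X, Y)) T‖ ≤ C * (1 + ‖T‖) ^ (-(5 : ℝ)) := by
  have hM : ∀ j : ℕ, ∃ M : ℝ, ∀ z : Spacetime × Spacetime,
      ‖iteratedFDeriv ℝ j χ z‖ ≤ M * (1 + ‖z.2‖) ^ (-(5 : ℝ)) := fun j => by
    have hcont := hχ.continuous_iteratedFDeriv (m := j) (by exact_mod_cast le_top)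
    have hpos : ∀ z : Spacetime × Spacetime, 0 < 1 + ‖z.2‖ := fun z => by positivity
    obtain ⟨M, hM⟩ := ((hc.iteratedFDeriv (𝕜 := ℝ) j).norm.mul_right
      (f' := fun z : Spacetime × Spacetime => (1 + ‖z.2‖) ^ (5 : ℝ))).exists_bound_of_continuous
      (hcont.norm.mul (Continuous.rpow_const (by fun_prop) fun z => Or.inl (hpos z).ne'))
    refine ⟨M, fun z => ?_⟩
    have := (le_abs_self _).trans (hM z)
    rw [Real.rpow_neg (hpos z).le, ← div_eq_mul_inv,
      le_div_iff₀ (Real.rpow_pos_of_pos (hpos z) _)]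
    exact this
  choose M hM using hM
  have hB : ∀ j ≤ 5, ∀ X, ∫ v, ‖iteratedFDeriv ℝ j (fun Y => χ (X, Y)) v‖
      ≤ ∑ j ∈ Finset.range 6, |M j| * ∫ T : Spacetime, (1 + ‖T‖) ^ (-(5 : ℝ)) := by
    intro j hj X
    have hI : 0 ≤ ∫ T : Spacetime, (1 + ‖T‖) ^ (-(5 : ℝ)) :=
      integral_nonneg fun T => by positivity
    refine le_trans ?_ (Finset.single_le_sum
      (f := fun j => |M j| * ∫ T : Spacetime, (1 + ‖T‖) ^ (-(5 : ℝ)))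
      (fun i _ => mul_nonneg (abs_nonneg _) hI) (Finset.mem_range.2 (Nat.lt_succ_of_le hj)))
    rw [← integral_const_mul]
    refine integral_mono (integrable_iteratedFDeriv (hχ.comp (contDiff_prodMk_right X))
      (hasCompactSupport_slice hc X) j) (integrable_one_add_norm_five.const_mul _) fun Y => ?_
    refine (norm_iteratedFDeriv_slice_le hχ X Y j).trans ((hM j (X, Y)).trans ?_)
    exact mul_le_mul_of_nonneg_right (le_abs_self _) (by positivity)
  obtain ⟨B, hB⟩ : ∃ B : ℝ, ∀ j ≤ 5, ∀ X,
      ∫ v, ‖iteratedFDeriv ℝ j (fun Y => χ (X, Y)) v‖ ≤ B := ⟨_, hB⟩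
  refine ⟨2 ^ 5 * (1 + (4 * Real.pi) ^ 5 * ((5 : ℕ) + 1)) * B, fun X T => ?_⟩
  exact_mod_cast minkFT_bound (hχ.comp (contDiff_prodMk_right X)) (hasCompactSupport_slice hc X) 5
    (fun j hj => hB j hj X) T

lemma continuous_minkFT_slice {χ : Spacetime × Spacetime → ℂ} (hχ : ContDiff ℝ ∞ χ)
    (hc : HasCompactSupport χ) :
    Continuous fun z : Spacetime × Spacetime => minkFT (fun Y => χ (z.1, Y)) z.2 := by
  obtain ⟨M, hM⟩ := (hc.norm.mul_right
    (f' := fun z : Spacetime × Spacetime => (1 + ‖z.2‖) ^ (5 : ℝ))).exists_bound_of_continuous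
    (hχ.continuous.norm.mul (Continuous.rpow_const (by fun_prop)
      fun z => Or.inl (show 0 < 1 + ‖z.2‖ by positivity).ne'))
  have hcont := hχ.continuous
  refine continuous_of_dominated (bound := fun Y => M * (1 + ‖Y‖) ^ (-(5 : ℝ)))
    (fun z => Continuous.aestronglyMeasurable (by fun_prop)) (fun z => ae_of_all _ fun Y => ?_)
    (integrable_one_add_norm_five.const_mul _) (ae_of_all _ fun Y => by fun_prop)
  have hpos : 0 < 1 + ‖Y‖ := by positivity
  have := (le_abs_self _).trans (hM (z.1, Y))
  rw [norm_mul, norm_phase, mul_one, Real.rpow_neg hpos.le, ← div_eq_mul_inv,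
    le_div_iff₀ (Real.rpow_pos_of_pos hpos _)]
  exact this

lemma hasCompactSupport_comp_smul {χ : Spacetime × Spacetime → ℂ} (hc : HasCompactSupport χ)
    {ε : ℝ} (hε : 0 < ε) : HasCompactSupport fun z => χ (ε • z) :=
  hc.comp_homeomorph (Homeomorph.smulOfNeZero ε hε.ne')

lemma integrable_cutoff {χ : Spacetime × Spacetime → ℂ} (hχ : IsCutoff χ)
    {ε : ℝ} (hε : 0 < ε) : Integrable fun z => χ (ε • z) :=
  Continuous.integrable_of_hasCompactSupport (hχ.1.continuous.comp (by fun_prop))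
    (hasCompactSupport_comp_smul hχ.2.1 hε)

/-- The regularized oscillatory integral of the plane wave `e^{i (u·X + v·Y)}`. The integral over
`Y` is a partial Fourier transform of `χ`, concentrated near `X = v`; the substitution
`X = v + ε T` leaves an integral which converges uniformly in `ε`. -/
lemma integral_cutoff_planeWave {χ : Spacetime × Spacetime → ℂ} (hχ : IsCutoff χ)
    {ε : ℝ} (hε : 0 < ε) (u v : Spacetime) :
    ∫ z : Spacetime × Spacetime,
        χ (ε • z) * phase (mink u z.1 + mink v z.2 - mink z.1 z.2)
      = ∫ T, minkFT (fun Y => χ (ε • v + ε ^ 2 • T, Y)) T * phase (mink u (v + ε • T)) := by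
  have hint : Integrable fun z : Spacetime × Spacetime =>
      χ (ε • z) * phase (mink u z.1 + mink v z.2 - mink z.1 z.2) :=
    Integrable.mul_phase (integrable_cutoff hχ hε) (by fun_prop)
  have hε4 : (ε ^ 4) ≠ 0 := by positivity
  have inner : ∀ X : Spacetime,
      ∫ Y, χ (ε • (X, Y)) * phase (mink u X + mink v Y - mink X Y)
        = phase (mink u X) * ((ε ^ 4)⁻¹ • minkFT (fun Y => χ (ε • X, Y)) (ε⁻¹ • (X - v))) := by
    intro X
    have h := Measure.integral_comp_smul_of_nonneg (volume : Measure Spacetime)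
      (fun Y => χ (ε • X, Y) * phase (-mink (ε⁻¹ • (X - v)) Y)) ε (hR := hε.le)
    rw [Module.finrank_fin_fun] at h
    rw [minkFT, ← h, ← integral_const_mul]
    refine integral_congr_ae (ae_of_all _ fun Y => ?_)
    simp only [Prod.smul_mk]
    rw [mul_left_comm, ← phase_add]
    congr 2
    rw [mink_smul_left, mink_smul_right, mink_sub_left]
    field_simp
    ring
  rw [Measure.volume_eq_prod] at hint ⊢
  rw [integral_prod _ hint]
  simp only [inner]
  rw [← integral_add_right_eq_self _ v]
  have h := Measure.integral_comp_smul_of_nonneg (volume : Measure Spacetime)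
    (fun X => phase (mink u (X + v)) * ((ε ^ 4)⁻¹ •
      minkFT (fun Y => χ (ε • (X + v), Y)) (ε⁻¹ • (X + v - v)))) ε (hR := hε.le)
  rw [Module.finrank_fin_fun, eq_inv_smul_iff₀ hε4] at h
  rw [← h, ← integral_smul]
  refine integral_congr_ae (ae_of_all _ fun T => ?_)
  simp only [add_sub_cancel_right, inv_smul_smul₀ hε.ne']
  rw [show ε • (ε • T + v) = ε • v + ε ^ 2 • T by rw [smul_add, smul_smul, add_comm, sq],
    add_comm (ε • T) v, mul_smul_comm, smul_inv_smul₀ hε4, mul_comm]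

/-- The regularized oscillatory integrals of the plane waves `e^{i (u·X + v·Y)}` are bounded
uniformly in `u`, `v` and the regularization. -/
lemma exists_bound_integral_cutoff_planeWave {χ : Spacetime × Spacetime → ℂ} (hχ : IsCutoff χ) :
    ∃ C : ℝ, ∀ ε : ℝ, 0 < ε → ∀ u v : Spacetime,
      ‖∫ z : Spacetime × Spacetime,
        χ (ε • z) * phase (mink u z.1 + mink v z.2 - mink z.1 z.2)‖ ≤ C := by
  obtain ⟨C, hC⟩ := exists_bound_minkFT_slice hχ.1 hχ.2.1
  refine ⟨∫ T : Spacetime, C * (1 + ‖T‖) ^ (-(5 : ℝ)), fun ε hε u v => ?_⟩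
  rw [integral_cutoff_planeWave hχ hε]
  refine norm_integral_le_of_norm_le (integrable_one_add_norm_five.const_mul C)
    (ae_of_all _ fun T => ?_)
  rw [norm_mul, norm_phase, mul_one]
  exact hC _ _

lemma tendsto_integral_cutoff_planeWave {χ : Spacetime × Spacetime → ℂ} (hχ : IsCutoff χ)
    (u v : Spacetime) :
    Tendsto (fun ε : ℝ => ∫ z : Spacetime × Spacetime,
        χ (ε • z) * phase (mink u z.1 + mink v z.2 - mink z.1 z.2)) (𝓝[>] 0)
      (𝓝 (((2 * Real.pi) ^ 4 : ℝ) * phase (mink u v))) := by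
  obtain ⟨C, hC⟩ := exists_bound_minkFT_slice hχ.1 hχ.2.1
  have hcont := continuous_minkFT_slice hχ.1 hχ.2.1
  have h0 : ((2 * Real.pi) ^ 4 : ℝ) * phase (mink u v)
      = ∫ T, minkFT (fun Y => χ ((0 : ℝ) • v + (0 : ℝ) ^ 2 • T, Y)) T
        * phase (mink u (v + (0 : ℝ) • T)) := by
    simp only [ne_eq, OfNat.ofNat_ne_zero, not_false_eq_true, zero_pow, zero_smul, add_zero]
    rw [integral_mul_const,
      integral_minkFT (g := fun Y => χ (0, Y)) (hχ.1.continuous.comp (by fun_prop))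
      (Continuous.integrable_of_hasCompactSupport (hχ.1.continuous.comp (by fun_prop))
        (hasCompactSupport_slice hχ.2.1 0)), hχ.2.2, mul_one]
    exact (integrable_one_add_norm_five.const_mul C).mono'
      (hcont.comp (Continuous.prodMk continuous_const continuous_id)).aestronglyMeasurable
      (ae_of_all _ fun T => hC 0 T)
  have hlim : Tendsto (fun ε : ℝ => ∫ T, minkFT (fun Y => χ (ε • v + ε ^ 2 • T, Y)) T
        * phase (mink u (v + ε • T))) (𝓝[>] 0)
      (𝓝 (((2 * Real.pi) ^ 4 : ℝ) * phase (mink u v))) := by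
    rw [h0]
    have hjoint : ∀ T, Continuous fun ε : ℝ => minkFT (fun Y => χ (ε • v + ε ^ 2 • T, Y)) T
        * phase (mink u (v + ε • T)) := fun T =>
      (hcont.comp (f := fun ε : ℝ => (ε • v + ε ^ 2 • T, T)) (by fun_prop)).mul (by fun_prop)
    refine tendsto_integral_filter_of_dominated_convergence
      (fun T => C * (1 + ‖T‖) ^ (-(5 : ℝ))) (Eventually.of_forall fun ε => ?_)
      (Eventually.of_forall fun ε => ae_of_all _ fun T => ?_)
      (integrable_one_add_norm_five.const_mul C)
      (ae_of_all _ fun T => ((hjoint T).tendsto 0).mono_left nhdsWithin_le_nhds)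
    · exact ((hcont.comp (f := fun T : Spacetime => (ε • v + ε ^ 2 • T, T)) (by fun_prop)).mul
        (by fun_prop)).aestronglyMeasurable
    · rw [norm_mul, norm_phase, mul_one]
      exact hC _ _
  refine hlim.congr' ?_
  filter_upwards [self_mem_nhdsWithin] with ε hε
  rw [integral_cutoff_planeWave hχ hε]

/-- The oscillatory integral of the Fourier transform `∫ h(p) e^{i (u(p)·X + v(p)·Y)} dν(p)` of an
integrable function. -/
theorem hasOscillatoryIntegral_fourier {χ : Spacetime × Spacetime → ℂ} (hχ : IsCutoff χ)
    {P : Type*} [MeasurableSpace P] {ν : Measure P} [SFinite ν] {h : P → ℂ} (hh : Integrable h ν)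
    {u v : P → Spacetime} (hu : Measurable u) (hv : Measurable v) :
    HasOscillatoryIntegral χ
      (fun z => ∫ p, h p * phase (mink (u p) z.1 + mink (v p) z.2) ∂ν)
      (∫ p, h p * phase (mink (u p) (v p)) ∂ν) := by
  have hprod : ∀ ε : ℝ, 0 < ε → Integrable (fun q : (Spacetime × Spacetime) × P =>
      (χ (ε • q.1) * h q.2) * phase (mink (u q.2) q.1.1 + mink (v q.2) q.1.2 - mink q.1.1 q.1.2))
      (volume.prod ν) := fun ε hε =>
    Integrable.mul_phase ((integrable_cutoff hχ hε).mul_prod hh) (by fun_prop)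
  have hinner : ∀ (ε : ℝ) (z : Spacetime × Spacetime),
      χ (ε • z) * (∫ p, h p * phase (mink (u p) z.1 + mink (v p) z.2) ∂ν)
          * Complex.exp (-Complex.I * (mink z.1 z.2 : ℝ))
        = ∫ p, (χ (ε • z) * h p) * phase (mink (u p) z.1 + mink (v p) z.2 - mink z.1 z.2) ∂ν := by
    intro ε z
    rw [exp_neg_I_mul, ← integral_const_mul, ← integral_mul_const]
    refine integral_congr_ae (ae_of_all _ fun p => ?_)
    simp only [sub_eq_add_neg, phase_add]
    ring
  refine ⟨fun ε hε => ?_, ?_⟩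
  · simp only [hinner]
    exact (hprod ε hε).integral_prod_left
  · obtain ⟨C, hC⟩ := exists_bound_integral_cutoff_planeWave hχ
    have hswap : ∀ ε : ℝ, 0 < ε → ∫ z : Spacetime × Spacetime,
        (∫ p, (χ (ε • z) * h p) * phase (mink (u p) z.1 + mink (v p) z.2 - mink z.1 z.2) ∂ν)
          = ∫ p, h p * (∫ z : Spacetime × Spacetime,
            χ (ε • z) * phase (mink (u p) z.1 + mink (v p) z.2 - mink z.1 z.2)) ∂ν := by
      intro ε hε
      rw [integral_integral_swap (hprod ε hε)]
      refine integral_congr_ae (ae_of_all _ fun p => ?_)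
      simp only
      rw [← integral_const_mul]
      refine integral_congr_ae (ae_of_all _ fun z => ?_)
      simp only
      ring
    have hlim : Tendsto (fun ε : ℝ => ∫ p, h p * (∫ z : Spacetime × Spacetime,
            χ (ε • z) * phase (mink (u p) z.1 + mink (v p) z.2 - mink z.1 z.2)) ∂ν) (𝓝[>] 0)
        (𝓝 (∫ p, h p * (((2 * Real.pi) ^ 4 : ℝ) * phase (mink (u p) (v p))) ∂ν)) := by
      refine tendsto_integral_filter_of_dominated_convergence (fun p => ‖h p‖ * C) ?_ ?_
        (hh.norm.mul_const C) (ae_of_all _ fun p =>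
          (tendsto_integral_cutoff_planeWave hχ (u p) (v p)).const_mul (h p))
      · filter_upwards [self_mem_nhdsWithin] with ε hε
        refine ((hprod ε hε).integral_prod_right.aestronglyMeasurable).congr
          (ae_of_all _ fun p => ?_)
        simp only
        rw [← integral_const_mul]
        refine integral_congr_ae (ae_of_all _ fun z => ?_)
        simp only
        ring
      · filter_upwards [self_mem_nhdsWithin] with ε hε
        refine ae_of_all _ fun p => ?_
        rw [norm_mul]
        exact mul_le_mul_of_nonneg_left (hC ε hε _ _) (norm_nonneg _)
    have hpi : (((2 * Real.pi) ^ 4 : ℝ) : ℂ) ≠ 0 := by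
      exact_mod_cast (by positivity : (2 * Real.pi) ^ 4 ≠ 0)
    have hfin : (((2 * Real.pi) ^ 4)⁻¹ : ℝ)
        * (∫ p, h p * (((2 * Real.pi) ^ 4 : ℝ) * phase (mink (u p) (v p))) ∂ν)
        = ∫ p, h p * phase (mink (u p) (v p)) ∂ν := by
      rw [← integral_const_mul]
      refine integral_congr_ae (ae_of_all _ fun p => ?_)
      simp only [Complex.ofReal_inv]
      field_simp
    rw [← hfin]
    refine (hlim.const_mul _).congr' ?_
    filter_upwards [self_mem_nhdsWithin] with ε hε
    simp only [hinner]
    rw [hswap ε hε]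

lemma HasOscillatoryIntegral.sum {χ : Spacetime × Spacetime → ℂ} {ι : Type*} {s : Finset ι}
    {F : ι → Spacetime × Spacetime → ℂ} {L : ι → ℂ}
    (h : ∀ i ∈ s, HasOscillatoryIntegral χ (F i) (L i)) :
    HasOscillatoryIntegral χ (fun z => ∑ i ∈ s, F i z) (∑ i ∈ s, L i) := by
  simp only [HasOscillatoryIntegral, Finset.mul_sum, Finset.sum_mul]
  refine ⟨fun ε hε => integrable_finsetSum _ fun i hi => (h i hi).1 ε hε, ?_⟩
  refine (tendsto_finsetSum s fun i hi => (h i hi).2).congr' ?_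
  filter_upwards [self_mem_nhdsWithin] with ε hε
  rw [integral_finsetSum _ fun i hi => (h i hi).1 ε hε, Finset.mul_sum]

lemma HasOscillatoryIntegral.unique {χ F : Spacetime × Spacetime → ℂ} {L L' : ℂ}
    (h : HasOscillatoryIntegral χ F L) (h' : HasOscillatoryIntegral χ F L') : L = L' :=
  tendsto_nhds_unique h.2 h'.2

/-- The iterated oscillatory integral of a finite sum of Fourier transforms of integrable
functions. -/
theorem hasIteratedOscillatoryIntegral_fourier {χ : Spacetime × Spacetime → ℂ} (hχ : IsCutoff χ)
    {ι : Type*} (s : Finset ι) {P : ι → Type*} [∀ i, MeasurableSpace (P i)]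
    (ν : ∀ i, Measure (P i)) [∀ i, SFinite (ν i)] (n : ℕ) (u v : ∀ i, Fin n → P i → Spacetime)
    (hu : ∀ i k, Measurable (u i k)) (hv : ∀ i k, Measurable (v i k)) (h : ∀ i, P i → ℂ)
    (hh : ∀ i, Integrable (h i) (ν i)) :
    HasIteratedOscillatoryIntegral χ n
      (fun z => ∑ i ∈ s, ∫ p, h i p
        * phase (∑ k, (mink (u i k p) (z k).1 + mink (v i k p) (z k).2)) ∂(ν i))
      (∑ i ∈ s, ∫ p, h i p * phase (∑ k, mink (u i k p) (v i k p)) ∂(ν i)) := by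
  induction n generalizing h with
  | zero => simp [HasIteratedOscillatoryIntegral]
  | succ n ih =>
    refine ⟨fun z => ∑ i ∈ s, ∫ p, (h i p * phase (∑ k : Fin n,
      mink (u i k.castSucc p) (v i k.castSucc p))) * phase (mink (u i (Fin.last n) p) z.1
        + mink (v i (Fin.last n) p) z.2) ∂(ν i), fun z => ?_, ?_⟩
    · have := ih (fun i k => u i k.castSucc) (fun i k => v i k.castSucc)
        (fun i k => hu i _) (fun i k => hv i _)
        (fun i p => h i p * phase (mink (u i (Fin.last n) p) z.1 + mink (v i (Fin.last n) p) z.2))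
        (fun i => Integrable.mul_phase (hh i) (by fun_prop))
      have e1 : ∀ i (w : Fin n → Spacetime × Spacetime) p, h i p * phase (∑ k : Fin (n + 1),
            (mink (u i k p) (Fin.snoc (α := fun _ => Spacetime × Spacetime) w z k).1
              + mink (v i k p) (Fin.snoc (α := fun _ => Spacetime × Spacetime) w z k).2))
          = h i p * phase (mink (u i (Fin.last n) p) z.1 + mink (v i (Fin.last n) p) z.2)
            * phase (∑ k : Fin n, (mink (u i k.castSucc p) (w k).1
              + mink (v i k.castSucc p) (w k).2)) := by
        intro i w p
        rw [Fin.sum_univ_castSucc, phase_add]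
        simp only [Fin.snoc_castSucc, Fin.snoc_last]
        ring
      simp only [e1]
      simp only [mul_right_comm _ (phase (∑ k : Fin n, _)) _]
      exact this
    · have e2 : ∀ i p, h i p * phase (∑ k, mink (u i k p) (v i k p))
          = h i p * phase (∑ k : Fin n, mink (u i k.castSucc p) (v i k.castSucc p))
            * phase (mink (u i (Fin.last n) p) (v i (Fin.last n) p)) := by
        intro i p
        rw [Fin.sum_univ_castSucc, phase_add, mul_assoc]
      simp only [e2]
      exact HasOscillatoryIntegral.sum fun i _ => hasOscillatoryIntegral_fourier hχ
        (Integrable.mul_phase (hh i) (by fun_prop)) (hu i _) (hv i _)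

/-! ### One-particle wave functions -/

lemma IsTestFunction.shift {f : Spacetime → ℂ} (hf : IsTestFunction f) (a : Spacetime) :
    IsTestFunction (shiftFn f a) :=
  ⟨hf.1.comp (contDiff_id.add contDiff_const), hf.2.comp_homeomorph (Homeomorph.addRight a)⟩

/-- The complex conjugate of a test function. -/
def conjFn (f : Spacetime → ℂ) : Spacetime → ℂ := fun x => conj (f x)

lemma conjFn_conjFn (f : Spacetime → ℂ) : conjFn (conjFn f) = f := by
  ext x; simp [conjFn]

lemma conjFn_shiftFn (f : Spacetime → ℂ) (a : Spacetime) :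
    conjFn (shiftFn f a) = shiftFn (conjFn f) a := rfl

lemma shiftFn_shiftFn (f : Spacetime → ℂ) (a b : Spacetime) :
    shiftFn (shiftFn f a) b = shiftFn f (a + b) := by
  ext x; simp only [shiftFn]; congr 1; abel

lemma shiftFn_zero (f : Spacetime → ℂ) : shiftFn f 0 = f := by
  ext x; simp [shiftFn]

lemma IsTestFunction.conj {f : Spacetime → ℂ} (hf : IsTestFunction f) :
    IsTestFunction (conjFn f) :=
  ⟨Complex.conjCLE.contDiff.comp hf.1, hf.2.comp_left (map_zero _)⟩

lemma IsTestFunction.integrable {f : Spacetime → ℂ} (hf : IsTestFunction f) : Integrable f :=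
  hf.1.continuous.integrable_of_hasCompactSupport hf.2

lemma oneParticle_eq_minkFT (m : ℝ) (f : Spacetime → ℂ) (p : Momentum) :
    oneParticle m f p = minkFT f (onShell m p) := by
  simp only [oneParticle, minkFT, exp_neg_I_mul]

lemma oneParticle_shiftFn (m : ℝ) (f : Spacetime → ℂ) (a : Spacetime) (p : Momentum) :
    oneParticle m (shiftFn f a) p = phase (mink (onShell m p) a) * oneParticle m f p := by
  rw [oneParticle_eq_minkFT, oneParticle_eq_minkFT, minkFT, minkFT,
    ← integral_sub_right_eq_self _ a, ← integral_const_mul]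
  refine integral_congr_ae (ae_of_all _ fun x => ?_)
  simp only [shiftFn, sub_add_cancel]
  rw [mul_left_comm, ← phase_add, mink_sub_right]
  congr 2
  ring

lemma norm_le_energy (m : ℝ) (p : Momentum) : ‖p‖ ≤ energy m p := by
  refine (pi_norm_le_iff_of_nonneg (Real.sqrt_nonneg _)).2 fun i => ?_
  refine Real.le_sqrt_of_sq_le ?_
  rw [Real.norm_eq_abs, sq_abs]
  fin_cases i <;> simp <;>
    nlinarith [sq_nonneg m, sq_nonneg (p 0), sq_nonneg (p 1), sq_nonneg (p 2)]

@[fun_prop]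
lemma continuous_energy (m : ℝ) : Continuous (energy m) := by unfold energy; fun_prop

@[fun_prop]
lemma continuous_onShell (m : ℝ) : Continuous (onShell m) := by
  refine continuous_pi fun i => ?_
  fin_cases i <;> simp [onShell] <;> fun_prop

@[fun_prop]
lemma measurable_onShell (m : ℝ) : Measurable (onShell m) := (continuous_onShell m).measurable

lemma norm_le_norm_onShell (m : ℝ) (p : Momentum) : ‖p‖ ≤ ‖onShell m p‖ := by
  refine (norm_le_energy m p).trans ?_
  have := norm_le_pi_norm (onShell m p) 0
  exact (le_abs_self _).trans this

instance (m : ℝ) : SigmaFinite (shellMeasure m) := by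
  unfold shellMeasure; infer_instance

lemma continuous_oneParticle (m : ℝ) {f : Spacetime → ℂ} (hf : IsTestFunction f) :
    Continuous (oneParticle m f) := by
  simp only [funext (oneParticle_eq_minkFT m f)]
  exact (continuous_minkFT hf.integrable).comp (continuous_onShell m)

/-- Even for `m = 0`, where the invariant measure has the density `1 / (2 |p|)`, this singularity is
integrable in three dimensions, so that `K f` is square integrable by its rapid decay. -/
lemma memLp_oneParticle (m : ℝ) {f : Spacetime → ℂ} (hf : IsTestFunction f) :
    MemLp (oneParticle m f) 2 (shellMeasure m) := by
  have hcont := continuous_oneParticle m hf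
  rw [memLp_two_iff_integrable_sq_norm hcont.aestronglyMeasurable]
  obtain ⟨C, hC⟩ : ∃ C : ℝ, ∀ T, ‖minkFT f T‖ ≤ C * (1 + ‖T‖) ^ (-(5 : ℝ)) := by
    set B := ∑ j ∈ Finset.range 6, ∫ v, ‖iteratedFDeriv ℝ j f v‖
    refine ⟨2 ^ 5 * (1 + (4 * Real.pi) ^ 5 * ((5 : ℕ) + 1)) * B, fun T => ?_⟩
    exact_mod_cast minkFT_bound hf.1 hf.2 5 (B := B) (fun j hj => Finset.single_le_sum
      (f := fun j => ∫ v, ‖iteratedFDeriv ℝ j f v‖)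
      (fun i _ => integral_nonneg fun _ => norm_nonneg _)
      (Finset.mem_range.2 (Nat.lt_succ_of_le hj))) T
  have hC0 : 0 ≤ C := by
    have := (norm_nonneg _).trans (hC 0)
    simpa using this
  have hmeas : Measurable fun p : Momentum => ((2 * Real.pi) ^ 3 * (2 * energy m p))⁻¹ := by
    fun_prop
  unfold shellMeasure
  rw [integrable_withDensity_iff (by fun_prop) (ae_of_all _ fun _ => ENNReal.ofReal_lt_top)]
  have hmaj : Integrable fun p : Momentum => C ^ 2 * ((1 + ‖p‖) ^ (-(5 : ℝ)) * ‖p‖⁻¹) := by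
    refine Integrable.const_mul ?_ _
    refine (integrable_fun_norm_addHaar (volume : Measure Momentum)
      (f := fun r => (1 + r) ^ (-(5 : ℝ)) * r⁻¹)).2 ?_
    have h1 : Integrable fun y : ℝ => (1 + ‖y‖) ^ (-(4 : ℝ)) :=
      integrable_one_add_norm (by simp)
    refine (h1.integrableOn (s := Set.Ioi 0)).mono' ?_ ?_
    · refine (Measurable.aestronglyMeasurable ?_)
      fun_prop
    · refine (ae_restrict_iff' measurableSet_Ioi).2 (ae_of_all _ fun y hy => ?_)
      have hy' : (0 : ℝ) < y := hy
      rw [Module.finrank_fin_fun, smul_eq_mul, Real.norm_of_nonneg (by positivity),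
        Real.norm_of_nonneg hy'.le]
      have e : (1 + y) ^ (-(4 : ℝ)) = (1 + y) ^ (-(5 : ℝ)) * (1 + y) := by
        rw [← Real.rpow_add_one (by positivity)]; norm_num
      rw [e]
      have : y ^ (3 - 1) * ((1 + y) ^ (-(5 : ℝ)) * y⁻¹) = (1 + y) ^ (-(5 : ℝ)) * y := by
        field_simp
      rw [this]
      gcongr
      linarith
  have hne : ∀ᵐ p : Momentum, p ≠ 0 := by simp [ae_iff, measure_singleton]
  refine hmaj.mono' ?_ (hne.mono fun p hp => ?_)
  · exact ((hcont.norm.pow 2).measurable.mul (by fun_prop)).aestronglyMeasurable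
  · rw [Real.norm_of_nonneg (by positivity)]
    have hr : 1 ≤ 1 + ‖p‖ := by linarith [norm_nonneg p]
    have h1 : ‖oneParticle m f p‖ ≤ C * (1 + ‖p‖) ^ (-(5 : ℝ)) := by
      rw [oneParticle_eq_minkFT]
      refine (hC _).trans (mul_le_mul_of_nonneg_left ?_ hC0)
      exact Real.rpow_le_rpow_of_nonpos (by positivity)
        (by linarith [norm_le_norm_onShell m p]) (by norm_num)
    have h2 : ((1 + ‖p‖) ^ (-(5 : ℝ))) ^ 2 ≤ (1 + ‖p‖) ^ (-(5 : ℝ)) := by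
      refine pow_le_of_le_one (by positivity) ?_ two_ne_zero
      exact Real.rpow_le_one_of_one_le_of_nonpos hr (by norm_num)
    have h3 : (ENNReal.ofReal ((2 * Real.pi) ^ 3 * (2 * energy m p))⁻¹).toReal ≤ ‖p‖⁻¹ := by
      have hE : 0 ≤ energy m p := Real.sqrt_nonneg _
      rw [ENNReal.toReal_ofReal (by positivity)]
      refine inv_anti₀ (norm_pos_iff.2 hp) ((norm_le_energy m p).trans ?_)
      have hπ : 1 ≤ (2 * Real.pi) ^ 3 := one_le_pow₀ (by linarith [Real.pi_gt_three])
      nlinarith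
    calc ‖oneParticle m f p‖ ^ 2 * _ ≤ (C * (1 + ‖p‖) ^ (-(5 : ℝ))) ^ 2 * ‖p‖⁻¹ := by gcongr
      _ = C ^ 2 * (((1 + ‖p‖) ^ (-(5 : ℝ))) ^ 2 * ‖p‖⁻¹) := by ring
      _ ≤ _ := by gcongr

/-! ### The domain of the field operators and the canonical commutation relations -/

/-- The one-particle scalar product `⟨u, v⟩ = ∫ conj (u(q)) v(q) dμ(q)`. -/
def oneInner (m : ℝ) (u v : Momentum → ℂ) : ℂ := ∫ q, conj (u q) * v q ∂(shellMeasure m)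

/-- The span of the vectors `a*(u₁) ⋯ a*(uₖ) Ω` with square integrable `uᵢ`. -/
inductive Dom (m : ℝ) : Fock → Prop
  | vacuum : Dom m DeformedQFT.vacuum
  | create {u : Momentum → ℂ} (hu : MemLp u 2 (shellMeasure m)) {ψ : Fock} (hψ : Dom m ψ) :
      Dom m (DeformedQFT.create u ψ)
  | add {ψ φ : Fock} (hψ : Dom m ψ) (hφ : Dom m φ) : Dom m (ψ + φ)
  | smul (c : ℂ) {ψ : Fock} (hψ : Dom m ψ) : Dom m (c • ψ)

lemma Dom.zero {m : ℝ} : Dom m 0 := by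
  simpa using Dom.smul 0 (Dom.vacuum (m := m))

lemma Dom.sum {m : ℝ} {ι : Type*} {s : Finset ι} {ψ : ι → Fock} (h : ∀ i, Dom m (ψ i)) :
    Dom m (∑ i ∈ s, ψ i) :=
  Finset.sum_induction _ _ (fun _ _ => Dom.add) Dom.zero fun i _ => h i

lemma memLp_mul_prod {α β : Type*} [MeasurableSpace α] [MeasurableSpace β] {μ : Measure α}
    {ν : Measure β} [SFinite μ] [SFinite ν] {f : α → ℂ} {g : β → ℂ} (hf : MemLp f 2 μ)
    (hg : MemLp g 2 ν) : MemLp (fun z : α × β => f z.1 * g z.2) 2 (μ.prod ν) := by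
  have hm : AEStronglyMeasurable (fun z : α × β => f z.1 * g z.2) (μ.prod ν) :=
    hf.1.comp_fst.mul hg.1.comp_snd
  rw [memLp_two_iff_integrable_sq_norm hm]
  have := ((memLp_two_iff_integrable_sq_norm hf.1).1 hf).mul_prod
    ((memLp_two_iff_integrable_sq_norm hg.1).1 hg)
  simpa only [norm_mul, mul_pow] using this

lemma integrable_conj_mul {α : Type*} [MeasurableSpace α] {μ : Measure α} {f g : α → ℂ}
    (hf : MemLp f 2 μ) (hg : MemLp g 2 μ) : Integrable (fun x => conj (f x) * g x) μ :=
  MemLp.integrable_mul hf.star hg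

/-- The `k`-particle components of vectors in the domain are square integrable. -/
lemma Dom.memLp {m : ℝ} {ψ : Fock} (hψ : Dom m ψ) (k : ℕ) :
    MemLp (ψ k) 2 (Measure.pi fun _ : Fin k => shellMeasure m) := by
  induction hψ generalizing k with
  | vacuum =>
    cases k with
    | zero =>
      rw [Measure.pi_of_empty]
      exact memLp_const 1
    | succ k => exact MemLp.zero
  | add _ _ h1 h2 => exact (h1 k).add (h2 k)
  | smul c _ h => exact (h k).const_smul c
  | @create u hu ψ _ h =>
    cases k with
    | zero => exact MemLp.zero
    | succ k =>
      have hj : ∀ j : Fin (k + 1), MemLp (fun p : Fin (k + 1) → Momentum =>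
          u (p j) * ψ k fun i => p (j.succAbove i)) 2
          (Measure.pi fun _ : Fin (k + 1) => shellMeasure m) := fun j =>
        (memLp_mul_prod hu (h k)).comp_measurePreserving
          (measurePreserving_piFinSuccAbove (fun _ : Fin (k + 1) => shellMeasure m) j)
      exact (memLp_finsetSum Finset.univ fun j _ => hj j).const_mul _

lemma cons_comp_succAbove_succ {α : Type*} {k : ℕ} (q : α) (p : Fin (k + 1) → α) (j : Fin (k + 1)) :
    (fun i => (Fin.cons q p : Fin (k + 2) → α) (j.succ.succAbove i))
      = Fin.cons q fun i => p (j.succAbove i) := by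
  ext i
  refine Fin.cases ?_ (fun i => ?_) i
  · simp
  · simp

/-- The wave functions of vectors in the domain are square integrable in the first variable, for
*all* values of the others, so that annihilation operators are given by convergent integrals. -/
lemma Dom.memLp_slice {m : ℝ} {ψ : Fock} (hψ : Dom m ψ) (k : ℕ) (p : Fin k → Momentum) :
    MemLp (fun q => ψ (k + 1) (Fin.cons q p)) 2 (shellMeasure m) := by
  induction hψ generalizing k with
  | vacuum => exact MemLp.zero
  | add _ _ h1 h2 => exact (h1 k p).add (h2 k p)
  | smul c _ h => exact (h k p).const_smul c
  | @create u hu ψ _ h =>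
    simp only [DeformedQFT.create]
    refine MemLp.const_mul (memLp_finsetSum (f := fun (j : Fin (k + 1)) q =>
      u ((Fin.cons q p : Fin (k + 1) → Momentum) j) *
        ψ k fun i => (Fin.cons q p : Fin (k + 1) → Momentum) (j.succAbove i)) _ fun j _ => ?_) _
    refine Fin.cases ?_ (fun j => ?_) j
    · simpa only [Fin.cons_zero, Fin.succAbove_zero, Fin.cons_succ] using hu.mul_const (ψ k p)
    · cases k with
      | zero => exact j.elim0
      | succ k =>
        simp only [Fin.cons_succ, cons_comp_succAbove_succ]
        exact (h k _).const_mul _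

lemma exists_perm_succAbove {k : ℕ} (σ : Equiv.Perm (Fin (k + 1))) (j : Fin (k + 1)) :
    ∃ τ : Equiv.Perm (Fin k), ∀ i, σ (j.succAbove i) = (σ j).succAbove (τ i) := by
  refine ⟨(finSuccAboveEquiv j).trans ((σ.subtypeEquiv fun a => by simp).trans
    (finSuccAboveEquiv (σ j)).symm), fun i => ?_⟩
  have h : ∀ x : {x : Fin (k + 1) // x ≠ σ j},
      (σ j).succAbove ((finSuccAboveEquiv (σ j)).symm x) = x := fun x =>
    congrArg Subtype.val ((finSuccAboveEquiv (σ j)).apply_symm_apply x)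
  simp only [Equiv.trans_apply, h]
  rfl

lemma Dom.comp_perm {m : ℝ} {ψ : Fock} (hψ : Dom m ψ) (k : ℕ) (σ : Equiv.Perm (Fin k))
    (p : Fin k → Momentum) : ψ k (fun i => p (σ i)) = ψ k p := by
  induction hψ generalizing k with
  | vacuum => cases k <;> rfl
  | add _ _ h1 h2 => exact congrArg₂ (· + ·) (h1 k σ p) (h2 k σ p)
  | smul c _ h => exact congrArg (c • ·) (h k σ p)
  | @create u hu ψ _ h =>
    cases k with
    | zero => rfl
    | succ k =>
      simp only [DeformedQFT.create]
      congr 1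
      refine Fintype.sum_equiv σ _ _ fun j => ?_
      obtain ⟨τ, hτ⟩ := exists_perm_succAbove σ j
      simp only [hτ]
      rw [h k τ fun i => p ((σ j).succAbove i)]

lemma Dom.eq_cons {m : ℝ} {ψ : Fock} (hψ : Dom m ψ) (k : ℕ) (j : Fin (k + 1))
    (p : Fin (k + 1) → Momentum) :
    ψ (k + 1) p = ψ (k + 1) (Fin.cons (p j) fun i => p (j.succAbove i)) := by
  rw [← hψ.comp_perm (k + 1) j.cycleRange.symm p]
  congr 1
  ext i
  refine Fin.cases ?_ (fun i => ?_) i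
  · simp
  · simp

lemma Dom.eventually_zero {m : ℝ} {ψ : Fock} (hψ : Dom m ψ) : ∃ K, ∀ k, K ≤ k → ψ k = 0 := by
  induction hψ with
  | vacuum =>
    refine ⟨1, fun k hk => ?_⟩
    obtain ⟨k, rfl⟩ := Nat.exists_eq_add_of_le' hk
    rfl
  | add _ _ h1 h2 =>
    obtain ⟨K, hK⟩ := h1
    obtain ⟨L, hL⟩ := h2
    refine ⟨max K L, fun k hk => ?_⟩
    rw [Pi.add_apply, hK k (le_of_max_le_left hk), hL k (le_of_max_le_right hk), add_zero]
  | smul c _ h =>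
    obtain ⟨K, hK⟩ := h
    exact ⟨K, fun k hk => by rw [Pi.smul_apply, hK k hk, smul_zero]⟩
  | create _ _ h =>
    obtain ⟨K, hK⟩ := h
    refine ⟨K + 1, fun k hk => ?_⟩
    obtain ⟨k, rfl⟩ := Nat.exists_eq_add_of_le' (Nat.one_le_of_lt hk)
    ext p
    simp [DeformedQFT.create, hK k (by omega)]

lemma create_add (u : Momentum → ℂ) (ψ φ : Fock) :
    create u (ψ + φ) = create u ψ + create u φ := by
  ext k p
  cases k with
  | zero => simp [create]
  | succ k => simp only [create, Pi.add_apply, mul_add, Finset.sum_add_distrib]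

lemma create_smul (u : Momentum → ℂ) (c : ℂ) (ψ : Fock) : create u (c • ψ) = c • create u ψ := by
  ext k p
  cases k with
  | zero => simp [create]
  | succ k =>
    simp only [create, Pi.smul_apply, smul_eq_mul, Finset.mul_sum]
    exact Finset.sum_congr rfl fun j _ => by ring

lemma annihilate_add {m : ℝ} {u : Momentum → ℂ} (hu : MemLp u 2 (shellMeasure m)) {ψ φ : Fock}
    (hψ : Dom m ψ) (hφ : Dom m φ) :
    annihilate m u (ψ + φ) = annihilate m u ψ + annihilate m u φ := by
  ext k p
  simp only [annihilate, Pi.add_apply, mul_add]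
  rw [integral_add (integrable_conj_mul hu (hψ.memLp_slice k p))
    (integrable_conj_mul hu (hφ.memLp_slice k p)), mul_add]

lemma annihilate_smul (m : ℝ) (u : Momentum → ℂ) (c : ℂ) (ψ : Fock) :
    annihilate m u (c • ψ) = c • annihilate m u ψ := by
  ext k p
  simp only [annihilate, Pi.smul_apply, smul_eq_mul]
  rw [mul_left_comm, ← integral_const_mul c]
  congr 1
  exact integral_congr_ae (ae_of_all _ fun q => mul_left_comm (conj (u q)) c _)

lemma annihilate_vacuum (m : ℝ) (u : Momentum → ℂ) : annihilate m u vacuum = 0 := by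
  ext k p
  simp [annihilate, vacuum]

/-- The canonical commutation relation `a(u) a*(v) - a*(v) a(u) = ⟨u, v⟩`. -/
lemma annihilate_create {m : ℝ} {u v : Momentum → ℂ} (hu : MemLp u 2 (shellMeasure m))
    (hv : MemLp v 2 (shellMeasure m)) {ψ : Fock} (hψ : Dom m ψ) :
    annihilate m u (create v ψ) = create v (annihilate m u ψ) + oneInner m u v • ψ := by
  ext k p
  have hs : ((Real.sqrt ((k : ℝ) + 1) : ℝ) : ℂ) ≠ 0 := by
    exact_mod_cast (Real.sqrt_pos.2 (by positivity)).ne'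
  have hsum : ∀ q, conj (u q) * create v ψ (k + 1) (Fin.cons q p)
      = ((Real.sqrt ((k : ℝ) + 1))⁻¹ : ℝ) * (conj (u q) * v q * ψ k p
        + ∑ j : Fin k, conj (u q) * (v (p j) *
          ψ k fun i => (Fin.cons q p : Fin (k + 1) → Momentum) (j.succ.succAbove i))) := by
    intro q
    simp only [create, Fin.sum_univ_succ, Fin.cons_zero, Fin.succAbove_zero, Fin.cons_succ,
      mul_add, Finset.mul_sum]
    congr 1
    · ring
    · exact Finset.sum_congr rfl fun j _ => by ring
  have h0 : Integrable (fun q => conj (u q) * v q * ψ k p) (shellMeasure m) :=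
    (integrable_conj_mul hu hv).mul_const _
  simp only [annihilate, hsum, Pi.add_apply, Pi.smul_apply, smul_eq_mul]
  rw [integral_const_mul, ← mul_assoc, Complex.ofReal_inv, mul_inv_cancel₀ hs, one_mul]
  cases k with
  | zero =>
    simp only [Finset.univ_eq_empty, Finset.sum_empty, add_zero, create, zero_add]
    rw [integral_mul_const]
    rfl
  | succ k =>
    have hj : ∀ j : Fin (k + 1), Integrable (fun q => conj (u q) * (v (p j) *
        ψ (k + 1) fun i => (Fin.cons q p : Fin (k + 2) → Momentum) (j.succ.succAbove i)))
        (shellMeasure m) := by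
      intro j
      simp only [cons_comp_succAbove_succ, mul_left_comm _ (v (p j))]
      exact (integrable_conj_mul hu (hψ.memLp_slice k _)).const_mul _
    rw [integral_add h0 (integrable_finsetSum _ fun j _ => hj j), integral_finsetSum _
      fun j _ => hj j, integral_mul_const, add_comm]
    congr 1
    have hs' : ((Real.sqrt ((k : ℝ) + 1) : ℝ) : ℂ) ≠ 0 := by
      exact_mod_cast (Real.sqrt_pos.2 (by positivity)).ne'
    simp only [create, annihilate, Finset.mul_sum]
    refine Finset.sum_congr rfl fun j _ => ?_
    simp only [cons_comp_succAbove_succ, mul_left_comm _ (v (p j)), integral_const_mul]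
    rw [Complex.ofReal_inv]
    field_simp

lemma Dom.annihilate {m : ℝ} {u : Momentum → ℂ} (hu : MemLp u 2 (shellMeasure m)) {ψ : Fock}
    (hψ : Dom m ψ) : Dom m (annihilate m u ψ) := by
  induction hψ with
  | vacuum => rw [annihilate_vacuum]; exact Dom.zero
  | add h1 h2 ih1 ih2 => rw [annihilate_add hu h1 h2]; exact ih1.add ih2
  | smul c _ ih => rw [annihilate_smul]; exact ih.smul c
  | create hv h ih => rw [annihilate_create hu hv h]; exact (ih.create hv).add (h.smul _)

lemma annihilate_comm {m : ℝ} {u v : Momentum → ℂ} (hu : MemLp u 2 (shellMeasure m))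
    (hv : MemLp v 2 (shellMeasure m)) {ψ : Fock} (hψ : Dom m ψ) :
    annihilate m u (annihilate m v ψ) = annihilate m v (annihilate m u ψ) := by
  induction hψ with
  | vacuum =>
    have h0 : ∀ w, DeformedQFT.annihilate m w 0 = 0 := fun w => by
      simpa using annihilate_smul m w 0 0
    simp only [annihilate_vacuum, h0]
  | add h1 h2 ih1 ih2 =>
    rw [annihilate_add hv h1 h2, annihilate_add hu h1 h2, annihilate_add hu (h1.annihilate hv)
      (h2.annihilate hv), annihilate_add hv (h1.annihilate hu) (h2.annihilate hu), ih1, ih2]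
  | smul c _ ih => simp only [annihilate_smul, ih]
  | create hw h ih =>
    rw [annihilate_create hv hw h, annihilate_create hu hw h,
      annihilate_add hu ((h.annihilate hv).create hw) (h.smul _),
      annihilate_add hv ((h.annihilate hu).create hw) (h.smul _),
      annihilate_create hu hw (h.annihilate hv), annihilate_create hv hw (h.annihilate hu), ih,
      annihilate_smul, annihilate_smul, add_assoc, add_assoc]
    congr 1
    exact add_comm _ _

lemma Dom.field {m : ℝ} {g : Spacetime → ℂ} (hg : IsTestFunction g) {ψ : Fock} (hψ : Dom m ψ) :
    Dom m (field m g ψ) :=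
  (hψ.create (memLp_oneParticle m hg)).add (hψ.annihilate (memLp_oneParticle m hg.conj))

lemma field_eq (m : ℝ) (g : Spacetime → ℂ) (ψ : Fock) : field m g ψ
    = create (oneParticle m g) ψ + annihilate m (oneParticle m (conjFn g)) ψ := rfl

lemma field_add {m : ℝ} {g : Spacetime → ℂ} (hg : IsTestFunction g) {ψ φ : Fock} (hψ : Dom m ψ)
    (hφ : Dom m φ) : field m g (ψ + φ) = field m g ψ + field m g φ := by
  simp only [field_eq]
  rw [create_add, annihilate_add (memLp_oneParticle m hg.conj) hψ hφ]
  abel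

lemma field_smul (m : ℝ) (g : Spacetime → ℂ) (c : ℂ) (ψ : Fock) :
    field m g (c • ψ) = c • field m g ψ := by
  simp only [field_eq]
  rw [create_smul, annihilate_smul, smul_add]

lemma field_sum {m : ℝ} {g : Spacetime → ℂ} (hg : IsTestFunction g) {ι : Type*} (s : Finset ι)
    {ψ : ι → Fock} (hψ : ∀ i, Dom m (ψ i)) :
    field m g (∑ i ∈ s, ψ i) = ∑ i ∈ s, field m g (ψ i) := by
  classical
  induction s using Finset.induction_on with
  | empty => simpa using field_smul m g 0 0
  | insert a s ha ih =>
    rw [Finset.sum_insert ha, Finset.sum_insert ha, field_add hg (hψ a) (Dom.sum hψ), ih]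

lemma annihilate_field {m : ℝ} {u : Momentum → ℂ} (hu : MemLp u 2 (shellMeasure m))
    {g : Spacetime → ℂ} (hg : IsTestFunction g) {ψ : Fock} (hψ : Dom m ψ) :
    annihilate m u (field m g ψ)
      = field m g (annihilate m u ψ) + oneInner m u (oneParticle m g) • ψ := by
  have hK := memLp_oneParticle m hg
  have hK' := memLp_oneParticle m hg.conj
  rw [field_eq, field_eq, annihilate_add hu (hψ.create hK) (hψ.annihilate hK'),
    annihilate_create hu hK hψ, annihilate_comm hu hK' hψ]
  abel

/-! ### Vacuum expectation values -/

/-- The vector `φ(g₁) ⋯ φ(gₖ) Ω` for the list `[g₁, …, gₖ]`. -/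
def fieldVec (m : ℝ) (l : List (Spacetime → ℂ)) : Fock := l.foldr (field m) vacuum

lemma dom_fieldVec {m : ℝ} {l : List (Spacetime → ℂ)} (hl : ∀ g ∈ l, IsTestFunction g) :
    Dom m (fieldVec m l) := by
  induction l with
  | nil => exact Dom.vacuum
  | cons g l ih =>
    exact (ih fun g' hg' => hl g' (List.mem_cons_of_mem _ hg')).field (hl g List.mem_cons_self)

lemma fieldVector_iff {m : ℝ} {ψ : Fock} :
    FieldVector m ψ ↔
      ∃ l : List (Spacetime → ℂ), (∀ g ∈ l, IsTestFunction g) ∧ ψ = fieldVec m l := by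
  constructor
  · intro h
    induction h with
    | vacuum => exact ⟨[], by simp, rfl⟩
    | field g hg ψ _ ih =>
      obtain ⟨l, hl, rfl⟩ := ih
      exact ⟨g :: l, by simpa using ⟨hg, hl⟩, rfl⟩
  · rintro ⟨l, hl, rfl⟩
    induction l with
    | nil => exact FieldVector.vacuum
    | cons g l ih =>
      exact FieldVector.field g (hl g List.mem_cons_self) _
        (ih fun g' hg' => hl g' (List.mem_cons_of_mem _ hg'))

lemma fieldVec_ofFn_succ (m : ℝ) {n : ℕ} (F : Fin (n + 1) → Spacetime → ℂ) :
    fieldVec m (List.ofFn F)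
      = field m (F 0) (fieldVec m (List.ofFn fun i : Fin n => F i.succ)) := by
  simp [fieldVec, List.ofFn_succ]

lemma dom_fieldVec_ofFn {m : ℝ} {n : ℕ} {F : Fin n → Spacetime → ℂ}
    (hF : ∀ i, IsTestFunction (F i)) : Dom m (fieldVec m (List.ofFn F)) :=
  dom_fieldVec fun g hg => by
    obtain ⟨i, rfl⟩ := (List.mem_ofFn' _ _).1 hg
    exact hF i

/-- An annihilation operator contracts, in turn, with each of the fields. -/
lemma annihilate_fieldVec {m : ℝ} {u : Momentum → ℂ} (hu : MemLp u 2 (shellMeasure m)) {n : ℕ}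
    {F : Fin (n + 1) → Spacetime → ℂ} (hF : ∀ i, IsTestFunction (F i)) :
    annihilate m u (fieldVec m (List.ofFn F)) = ∑ j, oneInner m u (oneParticle m (F j)) •
      fieldVec m (List.ofFn fun i => F (j.succAbove i)) := by
  induction n with
  | zero =>
    rw [fieldVec_ofFn_succ, annihilate_field hu (hF 0) (dom_fieldVec_ofFn fun i => hF _)]
    have h0 : fieldVec m (List.ofFn fun i : Fin 0 => F i.succ) = vacuum := by simp [fieldVec]
    have h1 : field m (F 0) 0 = 0 := by simpa using field_smul m (F 0) 0 0
    rw [h0, annihilate_vacuum, h1, zero_add, Fin.sum_univ_succ]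
    simp [fieldVec]
  | succ n ih =>
    rw [fieldVec_ofFn_succ, annihilate_field hu (hF 0) (dom_fieldVec_ofFn fun i => hF _),
      ih fun i => hF _, field_sum (hF 0) _ fun j => (dom_fieldVec_ofFn fun i => hF _).smul _,
      Fin.sum_univ_succ (n := n + 1), add_comm]
    congr 1
    refine Finset.sum_congr rfl fun j _ => ?_
    rw [field_smul, fieldVec_ofFn_succ m fun i => F (j.succ.succAbove i)]
    simp only [Fin.succ_succAbove_zero, Fin.succ_succAbove_succ]

lemma fockInner_vacuum (m : ℝ) (ψ : Fock) : fockInner m vacuum ψ = ψ 0 Fin.elim0 := by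
  rw [fockInner, tsum_eq_single 0]
  · rw [Measure.pi_of_empty, integral_dirac]
    simp only [vacuum, map_one, one_mul]
    exact congrArg (ψ 0) (Subsingleton.elim _ _)
  · intro k hk
    obtain ⟨k, rfl⟩ := Nat.exists_eq_succ_of_ne_zero hk
    simp [vacuum]

lemma nPoint_nil (m : ℝ) : nPoint m [] = 1 := by
  rw [nPoint, fockInner_vacuum]; rfl

lemma nPoint_ofFn_succ (m : ℝ) {n : ℕ} (F : Fin (n + 1) → Spacetime → ℂ) :
    nPoint m (List.ofFn F) = annihilate m (oneParticle m (conjFn (F 0)))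
      (fieldVec m (List.ofFn fun i : Fin n => F i.succ)) 0 Fin.elim0 := by
  have : nPoint m (List.ofFn F) = fockInner m vacuum (fieldVec m (List.ofFn F)) := rfl
  rw [this, fockInner_vacuum, fieldVec_ofFn_succ]
  simp only [field, Pi.add_apply, create, zero_add]
  rfl

lemma nPoint_ofFn_one (m : ℝ) (F : Fin 1 → Spacetime → ℂ) :
    nPoint m (List.ofFn F) = 0 := by
  rw [nPoint_ofFn_succ m F]
  simp [fieldVec, annihilate_vacuum]

lemma nPoint_ofFn_add_two' {m : ℝ} {n : ℕ} {F : Fin (n + 2) → Spacetime → ℂ}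
    (hF : ∀ i, IsTestFunction (F i)) :
    nPoint m (List.ofFn F) = ∑ j : Fin (n + 1),
      oneInner m (oneParticle m (conjFn (F 0))) (oneParticle m (F j.succ))
        * nPoint m (List.ofFn fun i => F (j.succAbove i).succ) := by
  rw [nPoint_ofFn_succ m F, annihilate_fieldVec (memLp_oneParticle m (hF 0).conj) fun i => hF _]
  simp only [Finset.sum_apply, Pi.smul_apply, smul_eq_mul]
  refine Finset.sum_congr rfl fun j _ => ?_
  congr 1
  exact (fockInner_vacuum m _).symm

/-- The two-point function. -/
lemma nPoint_pair {m : ℝ} {f g : Spacetime → ℂ} (hf : IsTestFunction f) (hg : IsTestFunction g) :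
    nPoint m [f, g] = oneInner m (oneParticle m (conjFn f)) (oneParticle m g) := by
  have h := nPoint_ofFn_add_two' (m := m) (F := ![f, g]) fun i => by fin_cases i <;> simpa
  simpa [nPoint_nil] using h

/-- Wick's theorem in recursive form: the first field is contracted with each of the others. -/
lemma nPoint_ofFn_add_two {m : ℝ} {n : ℕ} {F : Fin (n + 2) → Spacetime → ℂ}
    (hF : ∀ i, IsTestFunction (F i)) :
    nPoint m (List.ofFn F) = ∑ j : Fin (n + 1), nPoint m [F 0, F j.succ]
        * nPoint m (List.ofFn fun i => F (j.succAbove i).succ) := by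
  rw [nPoint_ofFn_add_two' hF]
  simp only [nPoint_pair (hF _) (hF _)]

/-! ### Hermiticity of the field -/

lemma fockInner_conj_symm (m : ℝ) (ψ φ : Fock) :
    fockInner m ψ φ = conj (fockInner m φ ψ) := by
  simp only [fockInner, Complex.conj_tsum, ← integral_conj, map_mul, Complex.conj_conj, mul_comm]

lemma summable_fockInner {m : ℝ} {ψ : Fock} (hψ : Dom m ψ) (φ : Fock) : Summable fun k : ℕ =>
    ∫ p, conj (φ k p) * ψ k p ∂(Measure.pi fun _ : Fin k => shellMeasure m) := by
  obtain ⟨K, hK⟩ := hψ.eventually_zero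
  refine summable_of_ne_finset_zero (s := Finset.range K) fun k hk => ?_
  simp [hK k (by simpa using hk)]

lemma fockInner_add_right {m : ℝ} {ψ φ χ : Fock} (hψ : Dom m ψ) (hφ : Dom m φ) (hχ : Dom m χ) :
    fockInner m χ (ψ + φ) = fockInner m χ ψ + fockInner m χ φ := by
  rw [fockInner, fockInner, fockInner,
    ← (summable_fockInner hψ χ).tsum_add (summable_fockInner hφ χ)]
  congr 1
  ext k
  simp only [Pi.add_apply, mul_add]
  exact integral_add (integrable_conj_mul (hχ.memLp k) (hψ.memLp k))
    (integrable_conj_mul (hχ.memLp k) (hφ.memLp k))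

lemma fockInner_add_left {m : ℝ} {ψ φ χ : Fock} (hψ : Dom m ψ) (hφ : Dom m φ) (hχ : Dom m χ) :
    fockInner m (ψ + φ) χ = fockInner m ψ χ + fockInner m φ χ := by
  rw [fockInner_conj_symm, fockInner_add_right hψ hφ hχ, map_add, ← fockInner_conj_symm,
    ← fockInner_conj_symm]

/-- The annihilation operator is adjoint to the creation operator. By the symmetry of the wave
functions all terms of the creation operator give the same contribution. -/
lemma fockInner_create_left {m : ℝ} {u : Momentum → ℂ} (hu : MemLp u 2 (shellMeasure m))
    {ψ φ : Fock} (hψ : Dom m ψ) (hφ : Dom m φ) :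
    fockInner m (create u ψ) φ = fockInner m ψ (annihilate m u φ) := by
  rw [fockInner, ← (Nat.succ_injective).tsum_eq]
  swap
  · intro k hk
    cases k with
    | zero => simp [create] at hk
    | succ k => exact ⟨k, rfl⟩
  rw [fockInner]
  congr 1
  ext k
  set μ := shellMeasure m
  set Φ : Momentum × (Fin k → Momentum) → ℂ := fun z =>
    conj (u z.1 * ψ k z.2) * φ (k + 1) (Fin.cons z.1 z.2) with hΦ
  have hterm : ∀ (j : Fin (k + 1)) (p : Fin (k + 1) → Momentum),
      conj (u (p j) * ψ k fun i => p (j.succAbove i)) * φ (k + 1) p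
        = Φ (MeasurableEquiv.piFinSuccAbove (fun _ => Momentum) j p) := by
    intro j p
    rw [hφ.eq_cons k j p]
    rfl
  have hmp := fun j => measurePreserving_piFinSuccAbove (fun _ : Fin (k + 1) => μ) j
  have hint : ∀ j : Fin (k + 1), Integrable (fun p : Fin (k + 1) → Momentum =>
      Φ (MeasurableEquiv.piFinSuccAbove (fun _ => Momentum) j p))
      (Measure.pi fun _ : Fin (k + 1) => μ) := by
    intro j
    simp only [← hterm]
    exact integrable_conj_mul ((memLp_mul_prod hu (hψ.memLp k)).comp_measurePreserving (hmp j))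
      (hφ.memLp (k + 1))
  have hΦint : Integrable Φ (μ.prod (Measure.pi fun _ : Fin k => μ)) :=
    ((hmp 0).integrable_comp_emb (MeasurableEquiv.measurableEmbedding _)).1 (hint 0)
  have hval : ∀ j : Fin (k + 1), ∫ p : Fin (k + 1) → Momentum,
      Φ (MeasurableEquiv.piFinSuccAbove (fun _ => Momentum) j p)
        ∂(Measure.pi fun _ : Fin (k + 1) => μ)
      = ∫ z, Φ z ∂(μ.prod (Measure.pi fun _ : Fin k => μ)) := fun j =>
    (hmp j).integral_comp' Φ
  have hs : ((Real.sqrt ((k : ℝ) + 1) : ℝ) : ℂ) ≠ 0 := by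
    exact_mod_cast (Real.sqrt_pos.2 (by positivity)).ne'
  have hs2 : ((Real.sqrt ((k : ℝ) + 1) : ℝ) : ℂ) * (Real.sqrt ((k : ℝ) + 1) : ℝ) = k + 1 := by
    rw [← Complex.ofReal_mul, Real.mul_self_sqrt (by positivity)]
    push_cast; rfl
  have hL : ∀ p, conj (create u ψ (k + 1) p) * φ (k + 1) p
      = ((Real.sqrt ((k : ℝ) + 1))⁻¹ : ℝ) * ∑ j : Fin (k + 1),
        Φ (MeasurableEquiv.piFinSuccAbove (fun _ => Momentum) j p) := by
    intro p
    simp only [create, map_mul, Complex.conj_ofReal, map_sum, ← hterm, Finset.mul_sum,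
      Finset.sum_mul, mul_assoc]
  have hR : ∀ p, conj (ψ k p) * annihilate m u φ k p
      = (Real.sqrt ((k : ℝ) + 1) : ℝ) * ∫ q, Φ (q, p) ∂μ := by
    intro p
    simp only [annihilate, hΦ]
    rw [mul_left_comm, ← integral_const_mul (conj (ψ k p))]
    congr 1
    refine integral_congr_ae (ae_of_all _ fun q => ?_)
    simp only [map_mul]
    ring
  simp only [Nat.succ_eq_add_one, hL, hR]
  rw [integral_const_mul, integral_finsetSum _ fun j _ => hint j, integral_const_mul]
  simp only [hval, Finset.sum_const, Finset.card_univ, Fintype.card_fin, nsmul_eq_mul]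
  rw [integral_prod_symm _ hΦint, Complex.ofReal_inv]
  push_cast
  rw [← hs2]
  field_simp

lemma fockInner_annihilate_left {m : ℝ} {u : Momentum → ℂ} (hu : MemLp u 2 (shellMeasure m))
    {ψ φ : Fock} (hψ : Dom m ψ) (hφ : Dom m φ) :
    fockInner m (annihilate m u ψ) φ = fockInner m ψ (create u φ) := by
  rw [fockInner_conj_symm, ← fockInner_create_left hu hφ hψ, ← fockInner_conj_symm]

lemma fockInner_field_left {m : ℝ} {g : Spacetime → ℂ} (hg : IsTestFunction g) {ψ φ : Fock}
    (hψ : Dom m ψ) (hφ : Dom m φ) :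
    fockInner m (field m g ψ) φ = fockInner m ψ (field m (conjFn g) φ) := by
  have hK := memLp_oneParticle m hg
  have hK' := memLp_oneParticle m hg.conj
  rw [field_eq, field_eq, conjFn_conjFn, fockInner_add_left (hψ.create hK) (hψ.annihilate hK') hφ,
    fockInner_add_right (hφ.create hK') (hφ.annihilate hK) hψ, fockInner_create_left hK hψ hφ,
    fockInner_annihilate_left hK' hψ hφ, add_comm]

/-- Matrix elements between field vectors are `n`-point functions. -/
lemma fockInner_fieldVec {m : ℝ} {l' l : List (Spacetime → ℂ)} (hl' : ∀ g ∈ l', IsTestFunction g)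
    (hl : ∀ g ∈ l, IsTestFunction g) :
    fockInner m (fieldVec m l') (fieldVec m l) = nPoint m ((l'.map conjFn).reverse ++ l) := by
  induction l' generalizing l with
  | nil => rfl
  | cons g l' ih =>
    have hg : IsTestFunction g := hl' g List.mem_cons_self
    have hl'' : ∀ g ∈ l', IsTestFunction g := fun g' hg' => hl' g' (List.mem_cons_of_mem _ hg')
    have h1 : fieldVec m (g :: l') = field m g (fieldVec m l') := rfl
    have h2 : field m (conjFn g) (fieldVec m l) = fieldVec m (conjFn g :: l) := rfl
    rw [h1, fockInner_field_left hg (dom_fieldVec hl'') (dom_fieldVec hl), h2,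
      ih hl'' (by simpa using ⟨hg.conj, hl⟩)]
    simp

/-! ### Translation covariance -/

lemma translation_vacuum (m : ℝ) (a : Spacetime) : translation m a vacuum = vacuum := by
  ext k p
  cases k with
  | zero => simp [translation, vacuum, mink_zero_right]
  | succ k => simp [translation, vacuum]

lemma translation_translation (m : ℝ) (a b : Spacetime) (ψ : Fock) :
    translation m a (translation m b ψ) = translation m (a + b) ψ := by
  ext k p
  simp only [translation, exp_neg_I_mul]
  rw [← mul_assoc, ← phase_add, mink_add_left, neg_add]

lemma translation_zero (m : ℝ) (ψ : Fock) : translation m 0 ψ = ψ := by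
  ext k p
  simp [translation, mink_zero_left]

lemma translation_create (m : ℝ) (a : Spacetime) (g : Spacetime → ℂ) (ψ : Fock) :
    translation m a (create (oneParticle m g) ψ)
      = create (oneParticle m (shiftFn g (-a))) (translation m a ψ) := by
  ext k p
  cases k with
  | zero => simp [translation, create]
  | succ k =>
    simp only [translation, create, exp_neg_I_mul, Finset.mul_sum, oneParticle_shiftFn]
    refine Finset.sum_congr rfl fun j _ => ?_
    rw [Fin.sum_univ_succAbove _ j, mink_add_right, neg_add, phase_add, mink_neg_right,
      mink_comm a (onShell m (p j))]
    ring

lemma translation_annihilate (m : ℝ) (a : Spacetime) (g : Spacetime → ℂ) (ψ : Fock) :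
    translation m a (annihilate m (oneParticle m g) ψ)
      = annihilate m (oneParticle m (shiftFn g (-a))) (translation m a ψ) := by
  ext k p
  simp only [translation, annihilate, exp_neg_I_mul, oneParticle_shiftFn]
  rw [mul_left_comm, ← integral_const_mul (phase _)]
  congr 1
  refine integral_congr_ae (ae_of_all _ fun q => ?_)
  simp only [Fin.sum_univ_succ, Fin.cons_zero, Fin.cons_succ, mink_add_right, neg_add, phase_add,
    map_mul, conj_phase, mink_neg_right, neg_neg, mink_comm a (onShell m q)]
  have : phase (mink (onShell m q) a) * phase (-mink (onShell m q) a) = 1 := by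
    rw [← phase_add, add_neg_cancel, phase_zero]
  linear_combination (-phase (-mink a (∑ i, onShell m (p i))) * conj (oneParticle m g q)
    * ψ (k + 1) (Fin.cons q p)) * this

lemma translation_add (m : ℝ) (a : Spacetime) (ψ φ : Fock) :
    translation m a (ψ + φ) = translation m a ψ + translation m a φ := by
  ext k p
  simp [translation, mul_add]

lemma translation_field (m : ℝ) (a : Spacetime) (g : Spacetime → ℂ) (ψ : Fock) :
    translation m a (field m g ψ) = field m (shiftFn g (-a)) (translation m a ψ) := by
  rw [field_eq, field_eq, translation_add, translation_create, translation_annihilate,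
    conjFn_shiftFn]

lemma translateOp_field (m : ℝ) (a : Spacetime) (g : Spacetime → ℂ) :
    translateOp m a (field m g) = field m (shiftFn g (-a)) := by
  ext ψ : 1
  rw [translateOp, translation_field, translation_translation, add_neg_cancel, translation_zero]

lemma translation_fieldVec (m : ℝ) (a : Spacetime) (l : List (Spacetime → ℂ)) :
    translation m a (fieldVec m l) = fieldVec m (l.map fun g => shiftFn g (-a)) := by
  induction l with
  | nil => exact translation_vacuum m a
  | cons g l ih =>
    have h1 : fieldVec m (g :: l) = field m g (fieldVec m l) := rfl
    rw [h1, translation_field, ih]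
    rfl

/-! ### Wick's theorem -/

/-- The vertices of a graph other than `0` and `j + 1`, in increasing order. -/
def skipVertex {N : ℕ} (j : Fin (N + 1)) : Fin N ↪ Fin (N + 2) :=
  (Fin.succAboveEmb j).trans (Fin.succEmb (N + 1))

lemma skipVertex_apply {N : ℕ} (j : Fin (N + 1)) (i : Fin N) :
    skipVertex j i = (j.succAbove i).succ := rfl

lemma skipVertex_ne_zero {N : ℕ} (j : Fin (N + 1)) (i : Fin N) : skipVertex j i ≠ 0 :=
  Fin.succ_ne_zero _

lemma skipVertex_ne_succ {N : ℕ} (j : Fin (N + 1)) (i : Fin N) : skipVertex j i ≠ j.succ :=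
  fun h => Fin.succAbove_ne j i (Fin.succ_injective _ h)

lemma skipVertex_lt_iff {N : ℕ} (j : Fin (N + 1)) {a b : Fin N} :
    skipVertex j a < skipVertex j b ↔ a < b := by
  rw [skipVertex_apply, skipVertex_apply, Fin.succ_lt_succ_iff,
    (Fin.strictMono_succAbove j).lt_iff_lt]

lemma exists_skipVertex {N : ℕ} (j : Fin (N + 1)) {v : Fin (N + 2)} (h0 : v ≠ 0)
    (hj : v ≠ j.succ) : ∃ i, v = skipVertex j i := by
  obtain ⟨w, rfl⟩ := Fin.exists_succ_eq.2 h0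
  obtain ⟨i, hi⟩ := Fin.exists_succAbove_eq (fun h : w = j => hj (congrArg Fin.succ h))
  exact ⟨i, by rw [skipVertex_apply, hi]⟩

/-- The graph in which `0` is joined to `j + 1`, and the other vertices are joined according to
`G`. -/
def addEdge {N : ℕ} (j : Fin (N + 1)) (G : Finset (Fin N × Fin N)) :
    Finset (Fin (N + 2) × Fin (N + 2)) :=
  Finset.cons (0, j.succ) (G.map ((skipVertex j).prodMap (skipVertex j))) (by
    intro h
    obtain ⟨e, -, he⟩ := Finset.mem_map.1 h
    exact skipVertex_ne_zero j e.1 (congrArg Prod.fst he))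

lemma mem_addEdge {N : ℕ} {j : Fin (N + 1)} {G : Finset (Fin N × Fin N)}
    {e : Fin (N + 2) × Fin (N + 2)} : e ∈ addEdge j G ↔
      e = (0, j.succ) ∨ ∃ e' ∈ G, e = (skipVertex j e'.1, skipVertex j e'.2) := by
  simp only [addEdge, Finset.mem_cons, Finset.mem_map]
  refine or_congr Iff.rfl ⟨?_, ?_⟩
  · rintro ⟨e', h, rfl⟩; exact ⟨e', h, rfl⟩
  · rintro ⟨e', h, rfl⟩; exact ⟨e', h, rfl⟩

lemma skipVertex_mem_addEdge {N : ℕ} {j : Fin (N + 1)} {G : Finset (Fin N × Fin N)}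
    {e : Fin N × Fin N} : (skipVertex j e.1, skipVertex j e.2) ∈ addEdge j G ↔ e ∈ G := by
  rw [mem_addEdge]
  constructor
  · rintro (h | ⟨e', h, he⟩)
    · exact absurd (congrArg Prod.fst h) (skipVertex_ne_zero j _)
    · obtain ⟨h1, h2⟩ := Prod.ext_iff.1 he
      rwa [Prod.ext ((skipVertex j).injective h1) ((skipVertex j).injective h2)]
  · exact fun h => Or.inr ⟨e, h, rfl⟩

lemma isQuasiFreeGraph_addEdge {N : ℕ} (j : Fin (N + 1)) (G : Finset (Fin N × Fin N)) :
    IsQuasiFreeGraph (addEdge j G) ↔ IsQuasiFreeGraph G := by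
  constructor
  · rintro ⟨hlt, huniq⟩
    refine ⟨fun e he => (skipVertex_lt_iff j).1 (hlt _ (skipVertex_mem_addEdge.2 he)), fun v => ?_⟩
    obtain ⟨e, ⟨he, hev⟩, hu⟩ := huniq (skipVertex j v)
    rcases mem_addEdge.1 he with rfl | ⟨e', he', rfl⟩
    · exact (hev.elim (fun h => skipVertex_ne_zero j v h.symm)
        fun h => skipVertex_ne_succ j v h.symm).elim
    · refine ⟨e', ⟨he', hev.imp (fun h => (skipVertex j).injective h)
        fun h => (skipVertex j).injective h⟩, ?_⟩
      rintro e'' ⟨he'', hv⟩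
      have := hu _ ⟨skipVertex_mem_addEdge.2 he'',
        hv.imp (congrArg (skipVertex j)) (congrArg (skipVertex j))⟩
      obtain ⟨h1, h2⟩ := Prod.ext_iff.1 this
      exact Prod.ext ((skipVertex j).injective h1) ((skipVertex j).injective h2)
  · rintro ⟨hlt, huniq⟩
    refine ⟨fun e he => ?_, fun v => ?_⟩
    · rcases mem_addEdge.1 he with rfl | ⟨e', he', rfl⟩
      · exact Fin.succ_pos j
      · exact (skipVertex_lt_iff j).2 (hlt _ he')
    · by_cases hv : v = 0 ∨ v = j.succ
      · refine ⟨(0, j.succ), ⟨mem_addEdge.2 (Or.inl rfl), hv.imp Eq.symm Eq.symm⟩, ?_⟩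
        rintro e ⟨he, hev⟩
        rcases mem_addEdge.1 he with rfl | ⟨e', -, rfl⟩
        · rfl
        · exfalso
          rcases hv with rfl | rfl
          · exact hev.elim (skipVertex_ne_zero j _) (skipVertex_ne_zero j _)
          · exact hev.elim (skipVertex_ne_succ j _) (skipVertex_ne_succ j _)
      · obtain ⟨h0, hj⟩ := not_or.1 hv
        obtain ⟨i, rfl⟩ := exists_skipVertex j h0 hj
        obtain ⟨e, ⟨he, hei⟩, hu⟩ := huniq i
        refine ⟨_, ⟨skipVertex_mem_addEdge.2 he,
          hei.imp (congrArg (skipVertex j)) (congrArg (skipVertex j))⟩, ?_⟩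
        rintro e' ⟨he', hi⟩
        rcases mem_addEdge.1 he' with rfl | ⟨e'', he'', rfl⟩
        · exact (hi.elim (fun h => h0 h.symm) fun h => hj h.symm).elim
        · rw [hu e'' ⟨he'', hi.imp (fun h => (skipVertex j).injective h)
            fun h => (skipVertex j).injective h⟩]

lemma addEdge_injective {N : ℕ} {j j' : Fin (N + 1)} {G G' : Finset (Fin N × Fin N)}
    (h : addEdge j G = addEdge j' G') : j = j' ∧ G = G' := by
  have h0 : ((0 : Fin (N + 2)), j.succ) ∈ addEdge j' G' := h ▸ mem_addEdge.2 (Or.inl rfl)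
  obtain rfl : j = j' := by
    rcases mem_addEdge.1 h0 with h1 | ⟨e, -, h1⟩
    · exact Fin.succ_injective _ (congrArg Prod.snd h1)
    · exact absurd (congrArg Prod.fst h1).symm (skipVertex_ne_zero j' _)
  refine ⟨rfl, Finset.ext fun e => ?_⟩
  rw [← skipVertex_mem_addEdge (j := j), h, skipVertex_mem_addEdge]

lemma exists_eq_addEdge {N : ℕ} {G : Finset (Fin (N + 2) × Fin (N + 2))}
    (hG : IsQuasiFreeGraph G) : ∃ j G', G = addEdge j G' := by
  obtain ⟨hlt, huniq⟩ := hG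
  obtain ⟨⟨a, b⟩, ⟨he, hev⟩, -⟩ := huniq 0
  have hab : a < b := hlt _ he
  obtain rfl : a = 0 := hev.resolve_right fun h => by
    rw [show b = 0 from h] at hab
    exact absurd hab (Fin.not_lt_zero a)
  obtain ⟨j, rfl⟩ := Fin.exists_succ_eq.2 hab.ne'
  refine ⟨j, Finset.univ.filter fun e => (skipVertex j e.1, skipVertex j e.2) ∈ G,
    Finset.ext fun e => ?_⟩
  rw [mem_addEdge]
  constructor
  · intro heG
    by_cases hne : e = (0, j.succ)
    · exact Or.inl hne
    · -- the edge at `0` and at `j + 1` is `(0, j + 1)`, so `e` avoids these vertices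
      have hav : ∀ v, (v = 0 ∨ v = j.succ) → ¬(e.1 = v ∨ e.2 = v) := fun v hv hv' =>
        hne ((huniq v).unique ⟨heG, hv'⟩ ⟨he, hv.imp Eq.symm Eq.symm⟩)
      have h0 := not_or.1 (hav 0 (Or.inl rfl))
      have hj := not_or.1 (hav j.succ (Or.inr rfl))
      obtain ⟨x, hx⟩ := exists_skipVertex j h0.1 hj.1
      obtain ⟨y, hy⟩ := exists_skipVertex j h0.2 hj.2
      refine Or.inr ⟨(x, y), ?_, Prod.ext hx hy⟩
      rw [Finset.mem_filter]
      exact ⟨Finset.mem_univ _, by rwa [← hx, ← hy]⟩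
  · rintro (rfl | ⟨e', he', rfl⟩)
    · exact he
    · exact (Finset.mem_filter.1 he').2

lemma mem_quasiFreeGraphs {N : ℕ} {G : Finset (Fin N × Fin N)} :
    G ∈ quasiFreeGraphs N ↔ IsQuasiFreeGraph G := by
  simp [quasiFreeGraphs]

/-- Summation over quasi-free graphs according to the partner of the first vertex. -/
lemma sum_quasiFreeGraphs_add_two {N : ℕ} (w : Fin (N + 2) × Fin (N + 2) → ℂ) :
    ∑ G ∈ quasiFreeGraphs (N + 2), ∏ e ∈ G, w e
      = ∑ j : Fin (N + 1), w (0, j.succ) * ∑ G ∈ quasiFreeGraphs N,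
          ∏ e ∈ G, w (skipVertex j e.1, skipVertex j e.2) := by
  simp only [Finset.mul_sum]
  rw [Finset.sum_sigma']
  symm
  refine Finset.sum_bij (fun x _ => addEdge x.1 x.2) (fun x hx => ?_) (fun x _ y _ h => ?_)
    (fun G hG => ?_) fun x _ => ?_
  · rw [mem_quasiFreeGraphs, isQuasiFreeGraph_addEdge]
    exact mem_quasiFreeGraphs.1 (Finset.mem_sigma.1 hx).2
  · obtain ⟨h1, h2⟩ := addEdge_injective h
    exact Sigma.ext h1 (heq_of_eq h2)
  · have hG' := mem_quasiFreeGraphs.1 hG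
    obtain ⟨j, G', rfl⟩ := exists_eq_addEdge hG'
    exact ⟨⟨j, G'⟩, Finset.mem_sigma.2 ⟨Finset.mem_univ _,
      mem_quasiFreeGraphs.2 ((isQuasiFreeGraph_addEdge j G').1 hG')⟩, rfl⟩
  · rw [addEdge, Finset.prod_cons, Finset.prod_map]
    rfl

lemma quasiFreeGraphs_zero : quasiFreeGraphs 0 = {∅} := by
  ext G
  rw [mem_quasiFreeGraphs, Finset.mem_singleton]
  constructor
  · exact fun _ => Finset.eq_empty_of_forall_notMem fun e => e.1.elim0
  · rintro rfl
    exact ⟨by simp, fun v => v.elim0⟩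

/-- There is no quasi-free graph with an odd number of vertices. -/
lemma quasiFreeGraphs_odd {N : ℕ} (hN : Odd N) : quasiFreeGraphs N = ∅ := by
  obtain ⟨k, rfl⟩ := hN
  induction k with
  | zero =>
    refine Finset.eq_empty_of_forall_notMem fun G hG => ?_
    obtain ⟨hlt, huniq⟩ := mem_quasiFreeGraphs.1 hG
    obtain ⟨e, ⟨he, -⟩, -⟩ := huniq 0
    exact (hlt e he).ne (Subsingleton.elim (α := Fin 1) _ _)
  | succ k ih =>
    refine Finset.eq_empty_of_forall_notMem fun G hG => ?_
    have hG' : IsQuasiFreeGraph (N := (2 * k + 1) + 2) G := mem_quasiFreeGraphs.1 hG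
    obtain ⟨j, G', rfl⟩ := exists_eq_addEdge hG'
    have : G' ∈ quasiFreeGraphs (2 * k + 1) :=
      mem_quasiFreeGraphs.2 ((isQuasiFreeGraph_addEdge j G').1 hG')
    rw [ih] at this
    exact absurd this (Finset.notMem_empty _)

/-- **Wick's theorem**. -/
theorem nPoint_eq_wickSum {m : ℝ} {N : ℕ} {F : Fin N → Spacetime → ℂ}
    (hF : ∀ i, IsTestFunction (F i)) : nPoint m (List.ofFn F) = wickSum m F := by
  induction N using Nat.twoStepInduction with
  | zero => simp [wickSum, quasiFreeGraphs_zero, nPoint_nil]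
  | one => rw [nPoint_ofFn_one, wickSum, quasiFreeGraphs_odd odd_one, Finset.sum_empty]
  | more N ih _ =>
    rw [nPoint_ofFn_add_two hF, wickSum, sum_quasiFreeGraphs_add_two
      (fun e => nPoint m [F e.1, F e.2])]
    refine Finset.sum_congr rfl fun j _ => ?_
    rw [ih fun i => hF _]
    rfl

/-! ### Momentum space kernels of the `n`-point functions -/

/-- The momentum at the vertex `i` of a graph whose edges `e` carry the on-shell momenta `q e`: each
edge contributes its momentum at its target and minus its momentum at its source. The index `i` is a
natural number, with the value `0` outside the graph, so that it can be compared with positions in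
lists of test functions. -/
def vertexMomentum (m : ℝ) {N : ℕ} (G : Finset (Fin N × Fin N)) (q : G → Momentum) (i : ℕ) :
    Spacetime :=
  ∑ e : G, ((if (e.1.2 : ℕ) = i then onShell m (q e) else 0)
    - (if (e.1.1 : ℕ) = i then onShell m (q e) else 0))

@[fun_prop]
lemma measurable_vertexMomentum (m : ℝ) {N : ℕ} (G : Finset (Fin N × Fin N)) (i : ℕ) :
    Measurable fun q => vertexMomentum m G q i := by
  unfold vertexMomentum
  refine Finset.measurable_sum _ fun e _ => Measurable.sub ?_ ?_ <;> split_ifs <;> fun_prop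

lemma sum_mink_vertexMomentum (m : ℝ) {N : ℕ} (G : Finset (Fin N × Fin N)) (q : G → Momentum)
    (a : ℕ → Spacetime) :
    ∑ i ∈ Finset.range N, mink (vertexMomentum m G q i) (a i)
      = ∑ e : G, mink (onShell m (q e)) (a e.1.2 - a e.1.1) := by
  have hite : ∀ (p : Prop) [Decidable p] (X Y : Spacetime),
      mink (if p then X else 0) Y = if p then mink X Y else 0 := by
    intro p _ X Y
    split_ifs
    · rfl
    · exact mink_zero_left Y
  simp only [vertexMomentum, mink_sum_left, mink_sub_left, hite, mink_sub_right]
  rw [Finset.sum_comm]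
  refine Finset.sum_congr rfl fun e _ => ?_
  rw [Finset.sum_sub_distrib, Finset.sum_ite_eq, Finset.sum_ite_eq,
    if_pos (Finset.mem_range.2 e.1.2.2), if_pos (Finset.mem_range.2 e.1.1.2)]

/-- Translation invariance: the total momentum vanishes. -/
lemma sum_mink_vertexMomentum_const (m : ℝ) {N : ℕ} (G : Finset (Fin N × Fin N))
    (q : G → Momentum) (b : Spacetime) :
    ∑ i ∈ Finset.range N, mink (vertexMomentum m G q i) b = 0 := by
  rw [sum_mink_vertexMomentum m G q fun _ => b]
  simp [mink_zero_right]

/-- `h` is a kernel for the `N`-point function of the list `l`: the `N`-point function of the list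
of the functions `l i ∘ a i` is the Fourier transform of `h` in the variables `a`, where the
momentum dual to `a i` is the one at the vertex `i` of the graph. -/
def IsKernel (m : ℝ) (N : ℕ) (l : List (Spacetime → ℂ))
    (h : ∀ G : Finset (Fin N × Fin N), (G → Momentum) → ℂ) : Prop :=
  (∀ G, Integrable (h G) (Measure.pi fun _ : G => shellMeasure m)) ∧
  ∀ a : ℕ → Spacetime, nPoint m (l.mapIdx fun i g => shiftFn g (a i))
    = ∑ G ∈ quasiFreeGraphs N, ∫ q, h G q
        * phase (∑ i ∈ Finset.range N, mink (vertexMomentum m G q i) (a i))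
        ∂(Measure.pi fun _ : G => shellMeasure m)

/-- The kernel given by Wick's theorem. -/
def wickKernel (m : ℝ) {N : ℕ} (F : Fin N → Spacetime → ℂ) (G : Finset (Fin N × Fin N))
    (q : G → Momentum) : ℂ :=
  ∏ e : G, conj (oneParticle m (conjFn (F e.1.1)) (q e)) * oneParticle m (F e.1.2) (q e)

lemma oneInner_shiftFn (m : ℝ) (f g : Spacetime → ℂ) (a b : Spacetime) :
    oneInner m (oneParticle m (conjFn (shiftFn f a))) (oneParticle m (shiftFn g b))
      = ∫ q, conj (oneParticle m (conjFn f) q) * oneParticle m g q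
          * phase (mink (onShell m q) (b - a)) ∂(shellMeasure m) := by
  rw [oneInner]
  refine integral_congr_ae (ae_of_all _ fun q => ?_)
  simp only [conjFn_shiftFn, oneParticle_shiftFn, map_mul, conj_phase, mink_sub_right]
  rw [sub_eq_add_neg, phase_add]
  ring

lemma isKernel_wickKernel (m : ℝ) {N : ℕ} {F : Fin N → Spacetime → ℂ}
    (hF : ∀ i, IsTestFunction (F i)) : IsKernel m N (List.ofFn F) (wickKernel m F) := by
  refine ⟨fun G => ?_, fun a => ?_⟩
  · exact Integrable.fintype_prod (f := fun (e : G) p =>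
      conj (oneParticle m (conjFn (F e.1.1)) p) * oneParticle m (F e.1.2) p) fun e =>
      integrable_conj_mul (memLp_oneParticle m (hF _).conj) (memLp_oneParticle m (hF _))
  · have hl : (List.ofFn F).mapIdx (fun i g => shiftFn g (a i))
        = List.ofFn fun i => shiftFn (F i) (a i) := by
      refine List.ext_getElem (by simp) fun i h1 h2 => by simp
    rw [hl, nPoint_eq_wickSum fun i => (hF i).shift _, wickSum]
    refine Finset.sum_congr rfl fun G _ => ?_
    rw [← Finset.prod_coe_sort]
    simp only [nPoint_pair ((hF _).shift _) ((hF _).shift _), oneInner_shiftFn]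
    rw [← integral_fintype_prod_eq_prod (f := fun (e : G) p =>
      conj (oneParticle m (conjFn (F e.1.1)) p) * oneParticle m (F e.1.2) p
        * phase (mink (onShell m p) (a e.1.2 - a e.1.1)))]
    refine integral_congr_ae (ae_of_all _ fun q => ?_)
    simp only [wickKernel, sum_mink_vertexMomentum]
    rw [Finset.prod_mul_distrib]
    congr 1
    simp only [phase, Complex.ofReal_sum, Finset.mul_sum, Complex.exp_sum]

lemma exists_isKernel (m : ℝ) {l : List (Spacetime → ℂ)} (hl : ∀ g ∈ l, IsTestFunction g) {N : ℕ}
    (hN : l.length = N) : ∃ h, IsKernel m N l h := by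
  subst hN
  have := isKernel_wickKernel m (F := l.get) fun i => hl _ (List.get_mem l i)
  rw [List.ofFn_get] at this
  exact ⟨_, this⟩

lemma IsKernel.nPoint_eq {m : ℝ} {N : ℕ} {l : List (Spacetime → ℂ)}
    {h : ∀ G : Finset (Fin N × Fin N), (G → Momentum) → ℂ} (hh : IsKernel m N l h) :
    nPoint m l = ∑ G ∈ quasiFreeGraphs N, ∫ q, h G q ∂(Measure.pi fun _ : G => shellMeasure m) := by
  have h0 := hh.2 fun _ => 0
  have hl : l.mapIdx (fun _ g => shiftFn g 0) = l :=
    List.ext_getElem (by simp) fun i h1 h2 => by simp [shiftFn_zero]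
  rw [hl] at h0
  simpa only [mink_zero_right, Finset.sum_const_zero, phase_zero, mul_one] using h0

lemma IsKernel.shift {m : ℝ} {N : ℕ} {l : List (Spacetime → ℂ)}
    {h : ∀ G : Finset (Fin N × Fin N), (G → Momentum) → ℂ} (hh : IsKernel m N l h)
    (b : ℕ → Spacetime) :
    IsKernel m N (l.mapIdx fun i g => shiftFn g (b i)) fun G q => h G q
      * phase (∑ i ∈ Finset.range N, mink (vertexMomentum m G q i) (b i)) := by
  refine ⟨fun G => Integrable.mul_phase (hh.1 G) (by fun_prop), fun a => ?_⟩
  have hl : (l.mapIdx fun i g => shiftFn g (b i)).mapIdx (fun i g => shiftFn g (a i))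
      = l.mapIdx fun i g => shiftFn g (b i + a i) :=
    List.ext_getElem (by simp) fun i h1 h2 => by simp [shiftFn_shiftFn]
  rw [hl, hh.2]
  simp only [mink_add_right, Finset.sum_add_distrib, phase_add, mul_assoc]

/-! ### The deformed products -/

/-- The transpose of a matrix with respect to the Minkowski product. -/
def minkTranspose (Θ : Matrix (Fin 4) (Fin 4) ℝ) : Matrix (Fin 4) (Fin 4) ℝ :=
  diagonal ![-1, 1, 1, 1] * Θᵀ * diagonal ![-1, 1, 1, 1]

lemma mink_minkTranspose (Θ : Matrix (Fin 4) (Fin 4) ℝ) (X Y : Spacetime) :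
    mink (minkTranspose Θ *ᵥ X) Y = mink X (Θ *ᵥ Y) := by
  simp [minkTranspose, mink, mulVec, dotProduct, Fin.sum_univ_four, mul_diagonal, diagonal_mul]
  ring

@[fun_prop]
lemma Measurable.mulVec_const {α : Type*} [MeasurableSpace α] (Θ : Matrix (Fin 4) (Fin 4) ℝ)
    {X : α → Spacetime} (hX : Measurable X) : Measurable fun x => Θ *ᵥ X x :=
  (Continuous.matrix_mulVec continuous_const continuous_id).measurable.comp hX

/-- The phase of the deformed product of `n + 1` fields with momenta `κ c, …, κ (c + n)`, namely
`∑ κᵢ · Θ κⱼ` over `i < j`. -/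
def twist (Θ : Matrix (Fin 4) (Fin 4) ℝ) (κ : ℕ → Spacetime) (c n : ℕ) : ℝ :=
  ∑ k ∈ Finset.range n, mink (∑ i ∈ Finset.range (k + 1), κ (c + i)) (Θ *ᵥ κ (c + (k + 1)))

@[fun_prop]
lemma measurable_twist (m : ℝ) {N : ℕ} (G : Finset (Fin N × Fin N))
    (Θ : Matrix (Fin 4) (Fin 4) ℝ) (c n : ℕ) :
    Measurable fun q => twist Θ (vertexMomentum m G q) c n := by
  unfold twist
  fun_prop

/-- The integral of the kernel `h` with the phase of a deformed product of `n + 1` fields which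
stand to the right of `c` others. -/
def twistedSum (m : ℝ) (Θ : Matrix (Fin 4) (Fin 4) ℝ) (c n : ℕ) {N : ℕ}
    (h : ∀ G : Finset (Fin N × Fin N), (G → Momentum) → ℂ) : ℂ :=
  ∑ G ∈ quasiFreeGraphs N, ∫ q, h G q * phase (twist Θ (vertexMomentum m G q) c n)
    ∂(Measure.pi fun _ : G => shellMeasure m)

/-- The matrix elements of `S` between field vectors arise from the corresponding undeformed ones,
by insertion of the phases for the fields `φ(f i)`. The formula is required for every kernel of the
undeformed matrix element, so that it can be applied to kernels modified by translations. -/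
def HasTwistedElements (m : ℝ) (Θ : Matrix (Fin 4) (Fin 4) ℝ) (n : ℕ)
    (f : Fin (n + 1) → Spacetime → ℂ) (S : Fock → Fock → ℂ) : Prop :=
  ∀ l' l : List (Spacetime → ℂ), (∀ g ∈ l', IsTestFunction g) → (∀ g ∈ l, IsTestFunction g) →
    ∀ (N : ℕ) (h : ∀ G : Finset (Fin N × Fin N), (G → Momentum) → ℂ),
      N = l'.length + ((n + 1) + l.length) →
      IsKernel m N ((l'.map conjFn).reverse ++ (List.ofFn f ++ l)) h →
      S (fieldVec m l') (fieldVec m l) = twistedSum m Θ l'.length n h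

lemma mapIdx_shiftFn_eq_map {l : List (Spacetime → ℂ)} {a : ℕ → Spacetime} {b : Spacetime}
    (h : ∀ i < l.length, a i = b) :
    (l.mapIdx fun i g => shiftFn g (a i)) = l.map fun g => shiftFn g b :=
  List.ext_getElem (by simp) fun i h1 h2 => by
    have : i < l.length := by simpa using h2
    simp [h i this]

/-- The translations by which the fields are shifted in the integrand of the Rieffel product of a
product of `n` fields with another one, when there are `c` fields to the left. -/
def rieffelShift (c n : ℕ) (A B : Spacetime) (i : ℕ) : Spacetime :=
  if i < c then A else if i < c + n then 0 else if i = c + n then A - B else A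

lemma mapIdx_rieffelShift (l' l : List (Spacetime → ℂ)) {n : ℕ} (f : Fin (n + 1) → Spacetime → ℂ)
    (A B : Spacetime) :
    (((l'.map conjFn).reverse ++ (List.ofFn f ++ l)).mapIdx
        fun i g => shiftFn g (rieffelShift l'.length n A B i))
      = ((l'.map fun g => shiftFn g A).map conjFn).reverse ++
        (List.ofFn (fun i : Fin n => f i.castSucc) ++
          (shiftFn (f (Fin.last n)) (A - B) :: l.map fun g => shiftFn g A)) := by
  have hf : List.ofFn f = List.ofFn (fun i : Fin n => f i.castSucc) ++ [f (Fin.last n)] :=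
    List.ofFn_succ_last
  rw [hf, List.append_assoc, List.mapIdx_append, List.mapIdx_append, List.singleton_append,
    List.mapIdx_cons]
  have h1 : ((l'.map conjFn).reverse.mapIdx
      fun i g => shiftFn g (rieffelShift l'.length n A B i))
      = ((l'.map fun g => shiftFn g A).map conjFn).reverse := by
    rw [mapIdx_shiftFn_eq_map (b := A) fun i hi => ?_, List.map_reverse, List.map_map, List.map_map]
    · rfl
    · rw [rieffelShift, if_pos (by simpa using hi)]
  have h2 : ((List.ofFn fun i : Fin n => f i.castSucc).mapIdx fun i g =>
      shiftFn g (rieffelShift l'.length n A B (i + (l'.map conjFn).reverse.length)))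
      = List.ofFn fun i : Fin n => f i.castSucc := by
    rw [mapIdx_shiftFn_eq_map (a := fun i => rieffelShift l'.length n A B
      (i + (l'.map conjFn).reverse.length)) (b := 0) fun i hi => ?_]
    · simp only [shiftFn_zero]
      exact List.map_id' _
    · simp only [List.length_ofFn] at hi
      simp only [List.length_reverse, List.length_map]
      rw [rieffelShift, if_neg (by omega), if_pos (by omega)]
  rw [h1, h2, mapIdx_shiftFn_eq_map (a := fun i => rieffelShift l'.length n A B
      (i + 1 + (List.ofFn fun i : Fin n => f i.castSucc).length
        + (l'.map conjFn).reverse.length)) (b := A) fun i hi => ?_]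
  · congr 5
    simp only [List.length_reverse, List.length_map, List.length_ofFn]
    rw [rieffelShift, if_neg (by omega), if_neg (by omega), if_pos (by omega)]
  · simp only [List.length_reverse, List.length_map, List.length_ofFn]
    rw [rieffelShift, if_neg (by omega), if_neg (by omega), if_neg (by omega)]

lemma mulVec_sum_right (Θ : Matrix (Fin 4) (Fin 4) ℝ) {ι : Type*} (s : Finset ι)
    (X : ι → Spacetime) : Θ *ᵥ ∑ i ∈ s, X i = ∑ i ∈ s, Θ *ᵥ X i :=
  map_sum Θ.mulVecLin X s

/-- The phase of the integrand of the Rieffel product. By momentum conservation only the momenta of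
the deformed fields enter. -/
lemma sum_mink_rieffelShift (m : ℝ) {N : ℕ} (G : Finset (Fin N × Fin N)) (q : G → Momentum)
    {c n r : ℕ} (hN : N = c + ((n + 1) + r)) (A B : Spacetime) :
    ∑ i ∈ Finset.range N, mink (vertexMomentum m G q i) (rieffelShift c n A B i)
      = mink (-∑ i ∈ Finset.range n, vertexMomentum m G q (c + i)) A
        + mink (-vertexMomentum m G q (c + n)) B := by
  -- a common translation of all fields by `-A` does not change the phase
  have h0 := sum_mink_vertexMomentum_const m G q A
  have h1 : ∑ i ∈ Finset.range N, mink (vertexMomentum m G q i) (rieffelShift c n A B i)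
      = ∑ i ∈ Finset.range N, mink (vertexMomentum m G q i) (rieffelShift c n A B i - A) := by
    simp only [mink_sub_right, Finset.sum_sub_distrib, h0, sub_zero]
  have hl : ∀ i ∈ Finset.range c,
      mink (vertexMomentum m G q i) (rieffelShift c n A B i - A) = 0 := fun i hi => by
    rw [rieffelShift, if_pos (Finset.mem_range.1 hi), sub_self, mink_zero_right]
  have hr : ∀ i ∈ Finset.range r, mink (vertexMomentum m G q (c + (n + 1 + i)))
      (rieffelShift c n A B (c + (n + 1 + i)) - A) = 0 := fun i hi => by
    rw [rieffelShift, if_neg (by omega), if_neg (by omega), if_neg (by omega), sub_self,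
      mink_zero_right]
  have hm : ∀ i ∈ Finset.range n, mink (vertexMomentum m G q (c + i))
      (rieffelShift c n A B (c + i) - A) = -mink (vertexMomentum m G q (c + i)) A := fun i hi => by
    have := Finset.mem_range.1 hi
    rw [rieffelShift, if_neg (by omega), if_pos (by omega), zero_sub, mink_neg_right]
  have hn : rieffelShift c n A B (c + n) - A = -B := by
    rw [rieffelShift, if_neg (by omega), if_neg (by omega), if_pos rfl]
    abel
  rw [h1, congrArg Finset.range hN, Finset.sum_range_add, Finset.sum_range_add,
    Finset.sum_range_succ, Finset.sum_eq_zero hl, Finset.sum_eq_zero hr, Finset.sum_congr rfl hm, hn,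
    mink_neg_right, mink_neg_left, mink_neg_left, mink_sum_left, Finset.sum_neg_distrib]
  ring

/-- The Rieffel product with one more field: by the formula for oscillatory integrals of Fourier
transforms it contributes the phases of the last field with all the previous ones. -/
lemma HasTwistedElements.hasOscillatoryIntegral {m : ℝ} {χ : Spacetime × Spacetime → ℂ}
    (hχ : IsCutoff χ) {Θ : Matrix (Fin 4) (Fin 4) ℝ} {n : ℕ} {f : Fin (n + 2) → Spacetime → ℂ}
    (hf : ∀ i, IsTestFunction (f i)) {S : Fock → Fock → ℂ}
    (hS : HasTwistedElements m Θ n (fun i => f i.castSucc) S) {l' l : List (Spacetime → ℂ)}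
    (hl' : ∀ g ∈ l', IsTestFunction g) (hl : ∀ g ∈ l, IsTestFunction g) {N : ℕ}
    {h : ∀ G : Finset (Fin N × Fin N), (G → Momentum) → ℂ}
    (hN : N = l'.length + ((n + 1 + 1) + l.length))
    (hh : IsKernel m N ((l'.map conjFn).reverse ++ (List.ofFn f ++ l)) h) :
    HasOscillatoryIntegral χ
      (fun z => S (translation m (-(Θ *ᵥ z.1)) (fieldVec m l'))
        (translation m (-(Θ *ᵥ z.1)) (translateOp m z.2 (field m (f (Fin.last (n + 1))))
          (fieldVec m l)))) (twistedSum m Θ l'.length (n + 1) h) := by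
  have hF : ∀ z : Spacetime × Spacetime,
      S (translation m (-(Θ *ᵥ z.1)) (fieldVec m l'))
        (translation m (-(Θ *ᵥ z.1)) (translateOp m z.2 (field m (f (Fin.last (n + 1))))
          (fieldVec m l)))
      = ∑ G ∈ quasiFreeGraphs N, ∫ q,
          (h G q * phase (twist Θ (vertexMomentum m G q) l'.length n))
          * phase (mink (minkTranspose Θ *ᵥ
              (-∑ i ∈ Finset.range (n + 1), vertexMomentum m G q (l'.length + i))) z.1
            + mink (-vertexMomentum m G q (l'.length + (n + 1))) z.2)
          ∂(Measure.pi fun _ : G => shellMeasure m) := by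
    intro z
    have e1 : translation m (-(Θ *ᵥ z.1)) (translateOp m z.2 (field m (f (Fin.last (n + 1))))
        (fieldVec m l)) = fieldVec m (shiftFn (f (Fin.last (n + 1))) (Θ *ᵥ z.1 - z.2)
          :: l.map fun g => shiftFn g (Θ *ᵥ z.1)) := by
      have : field m (shiftFn (f (Fin.last (n + 1))) (-z.2)) (fieldVec m l)
        = fieldVec m (shiftFn (f (Fin.last (n + 1))) (-z.2) :: l) := rfl
      rw [translateOp_field, this, translation_fieldVec, List.map_cons, shiftFn_shiftFn, neg_neg,
        neg_add_eq_sub]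
    rw [e1, translation_fieldVec, neg_neg]
    have hk := hh.shift (rieffelShift l'.length (n + 1) (Θ *ᵥ z.1) z.2)
    rw [mapIdx_rieffelShift] at hk
    rw [hS (l'.map fun g => shiftFn g (Θ *ᵥ z.1))
      (shiftFn (f (Fin.last (n + 1))) (Θ *ᵥ z.1 - z.2) :: l.map fun g => shiftFn g (Θ *ᵥ z.1))
      (fun g hg => ?_) (fun g hg => ?_) N _ ?_ hk, twistedSum]
    · refine Finset.sum_congr rfl fun G _ => integral_congr_ae (ae_of_all _ fun q => ?_)
      simp only [List.length_map]
      rw [sum_mink_rieffelShift m G q hN, mink_minkTranspose]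
      ring
    · simp only [List.length_map, List.length_cons]
      omega
    · obtain ⟨g', hg', rfl⟩ := List.mem_map.1 hg
      exact (hl' g' hg').shift _
    · rcases List.mem_cons.1 hg with rfl | hg
      · exact (hf _).shift _
      · obtain ⟨g', hg', rfl⟩ := List.mem_map.1 hg
        exact (hl g' hg').shift _
  simp only [hF]
  have hval : twistedSum m Θ l'.length (n + 1) h
      = ∑ G ∈ quasiFreeGraphs N, ∫ q,
          (h G q * phase (twist Θ (vertexMomentum m G q) l'.length n))
          * phase (mink (minkTranspose Θ *ᵥ
              (-∑ i ∈ Finset.range (n + 1), vertexMomentum m G q (l'.length + i)))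
            (-vertexMomentum m G q (l'.length + (n + 1))))
          ∂(Measure.pi fun _ : G => shellMeasure m) := by
    refine Finset.sum_congr rfl fun G _ => integral_congr_ae (ae_of_all _ fun q => ?_)
    simp only
    rw [twist, Finset.sum_range_succ, phase_add, mul_assoc, mink_minkTranspose, mulVec_neg,
      mink_neg_left, mink_neg_right, neg_neg]
    rfl
  rw [hval]
  exact HasOscillatoryIntegral.sum fun G _ => hasOscillatoryIntegral_fourier hχ
    (Integrable.mul_phase (hh.1 G) (by fun_prop)) (by fun_prop) (by fun_prop)

lemma forall_mem_ops {n : ℕ} {f : Fin n → Spacetime → ℂ} (hf : ∀ i, IsTestFunction (f i))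
    {l' l : List (Spacetime → ℂ)} (hl' : ∀ g ∈ l', IsTestFunction g)
    (hl : ∀ g ∈ l, IsTestFunction g) :
    ∀ g ∈ (l'.map conjFn).reverse ++ (List.ofFn f ++ l), IsTestFunction g := by
  intro g hg
  rcases List.mem_append.1 hg with hg | hg
  · obtain ⟨g', hg', rfl⟩ := List.mem_map.1 (List.mem_reverse.1 hg)
    exact (hl' g' hg').conj
  · rcases List.mem_append.1 hg with hg | hg
    · obtain ⟨i, rfl⟩ := (List.mem_ofFn' _ _).1 hg
      exact hf i
    · exact hl g hg

/-- The matrix elements of deformed products. -/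
theorem IsDeformedFieldProduct.hasTwistedElements {m : ℝ} {χ : Spacetime × Spacetime → ℂ}
    (hχ : IsCutoff χ) {Θ : Matrix (Fin 4) (Fin 4) ℝ} {n : ℕ} {f : Fin (n + 1) → Spacetime → ℂ}
    (hf : ∀ i, IsTestFunction (f i)) {T : Fock → Fock → ℂ}
    (hT : IsDeformedFieldProduct m χ Θ n f T) : HasTwistedElements m Θ n f T := by
  induction n generalizing T with
  | zero =>
    intro l' l hl' hl N h hN hh
    have h1 : field m (f 0) (fieldVec m l) = fieldVec m (f 0 :: l) := rfl
    rw [hT _ _ (fieldVector_iff.2 ⟨l', hl', rfl⟩) (fieldVector_iff.2 ⟨l, hl, rfl⟩), h1,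
      fockInner_fieldVec hl' (by simpa using ⟨hf 0, hl⟩)]
    have h2 : List.ofFn f ++ l = f 0 :: l := by simp
    rw [h2] at hh
    rw [hh.nPoint_eq]
    simp [twistedSum, twist, phase_zero]
  | succ n ih =>
    intro l' l hl' hl N h hN hh
    obtain ⟨S, hS, hTS⟩ := hT
    exact (hTS _ _ (fieldVector_iff.2 ⟨l', hl', rfl⟩) (fieldVector_iff.2 ⟨l, hl, rfl⟩)).unique
      ((ih (fun i => hf _) hS).hasOscillatoryIntegral hχ hf hl' hl hN hh)

theorem exists_isDeformedFieldProduct (m : ℝ) {χ : Spacetime × Spacetime → ℂ}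
    (hχ : IsCutoff χ) (Θ : Matrix (Fin 4) (Fin 4) ℝ) {n : ℕ} {f : Fin (n + 1) → Spacetime → ℂ}
    (hf : ∀ i, IsTestFunction (f i)) : ∃ T, IsDeformedFieldProduct m χ Θ n f T := by
  induction n with
  | zero => exact ⟨fun ψ' ψ => fockInner m ψ' (field m (f 0) ψ), fun _ _ _ _ => rfl⟩
  | succ n ih =>
    obtain ⟨S, hS⟩ := ih (f := fun i => f i.castSucc) fun i => hf _
    have hex : ∀ ψ' ψ : Fock, FieldVector m ψ' → FieldVector m ψ → ∃ L,
        HasOscillatoryIntegral χ (fun z => S (translation m (-(Θ *ᵥ z.1)) ψ')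
          (translation m (-(Θ *ᵥ z.1)) (translateOp m z.2 (field m (f (Fin.last (n + 1)))) ψ)))
          L := by
      intro ψ' ψ hψ' hψ
      obtain ⟨l', hl', rfl⟩ := fieldVector_iff.1 hψ'
      obtain ⟨l, hl, rfl⟩ := fieldVector_iff.1 hψ
      obtain ⟨h, hh⟩ := exists_isKernel m (forall_mem_ops hf hl' hl)
        (N := l'.length + ((n + 1 + 1) + l.length)) (by simp; omega)
      exact ⟨_, (hS.hasTwistedElements hχ fun i => hf _).hasOscillatoryIntegral hχ hf hl' hl rfl hh⟩
    choose! T hT using hex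
    exact ⟨T, S, hS, hT⟩

/-! ### The deformed state -/

lemma twistedSum_zero {m : ℝ} {N : ℕ} {l : List (Spacetime → ℂ)}
    {h : ∀ G : Finset (Fin N × Fin N), (G → Momentum) → ℂ} (hh : IsKernel m N l h) (c n : ℕ) :
    twistedSum m 0 c n h = nPoint m l := by
  simp [hh.nPoint_eq, twistedSum, twist, zero_mulVec, mink_zero_right, phase_zero]

lemma continuous_twistedSum {m : ℝ} {N : ℕ} {l : List (Spacetime → ℂ)}
    {h : ∀ G : Finset (Fin N × Fin N), (G → Momentum) → ℂ} (hh : IsKernel m N l h) (c n : ℕ) :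
    Continuous fun Θ => twistedSum m Θ c n h := by
  have : FirstCountableTopology (Matrix (Fin 4) (Fin 4) ℝ) :=
    inferInstanceAs (FirstCountableTopology (Fin 4 → Fin 4 → ℝ))
  refine continuous_finsetSum _ fun G _ => ?_
  refine continuous_of_dominated (bound := fun q => ‖h G q‖) (fun Θ => ?_) (fun Θ => ?_)
    (hh.1 G).norm (ae_of_all _ fun q => ?_)
  · exact (Integrable.mul_phase (hh.1 G) (by fun_prop)).aestronglyMeasurable
  · exact ae_of_all _ fun q => by rw [norm_mul, norm_phase, mul_one]
  · refine continuous_const.mul (continuous_phase.comp ?_)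
    unfold twist
    exact continuous_finsetSum _ fun k _ =>
      Continuous.mink continuous_const (Continuous.matrix_mulVec continuous_id continuous_const)

/-- The translations in the graph expansion, sorted by the integration variables. -/
lemma sum_mink_shifted (κ : ℕ → Spacetime) (Θ : Matrix (Fin 4) (Fin 4) ℝ) {n : ℕ}
    (z : Fin n → Spacetime × Spacetime) :
    ∑ i : Fin (n + 1), mink (κ i) (Fin.cases (motive := fun _ => Spacetime) 0 (fun j => (z j).2) i
        + Θ *ᵥ ∑ k : Fin n with i ≤ k.castSucc, (z k).1)
      = ∑ k : Fin n, (mink (minkTranspose Θ *ᵥ ∑ i ∈ Finset.range (k + 1), κ (0 + i)) (z k).1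
        + mink (κ (0 + (k + 1))) (z k).2) := by
  have hx : ∀ k : Fin n, ∑ i : Fin (n + 1),
      (if i ≤ k.castSucc then mink (κ i) (Θ *ᵥ (z k).1) else 0)
        = ∑ i ∈ Finset.range (k + 1), mink (κ i) (Θ *ᵥ (z k).1) := by
    intro k
    have hk : (k : ℕ) < n := k.2
    rw [Finset.sum_congr rfl fun i hi => (if_pos (Nat.lt_succ_iff.1 (Finset.mem_range.1 hi))).symm,
      Finset.sum_subset (Finset.range_mono (show (k : ℕ) + 1 ≤ n + 1 by omega)) fun i _ hi =>
        if_neg fun h => hi (Finset.mem_range.2 (Nat.lt_succ_iff.2 h)), Finset.sum_range]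
    rfl
  simp only [mink_add_right, Finset.sum_add_distrib, mulVec_sum_right, mink_sum_right,
    zero_add, mink_minkTranspose, mink_sum_left]
  simp only [Finset.sum_filter]
  rw [Finset.sum_comm, add_comm]
  congr 1
  · exact Finset.sum_congr rfl fun k _ => hx k
  · rw [Fin.sum_univ_succ]
    simp [mink_zero_right]

/-- The graph expansion of the deformed `n`-point function. -/
theorem hasIteratedOscillatoryIntegral_wickSum {m : ℝ} {χ : Spacetime × Spacetime → ℂ}
    (hχ : IsCutoff χ) (Θ : Matrix (Fin 4) (Fin 4) ℝ) {n : ℕ} {f : Fin (n + 1) → Spacetime → ℂ}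
    (hf : ∀ i, IsTestFunction (f i))
    {h : ∀ G : Finset (Fin (n + 1) × Fin (n + 1)), (G → Momentum) → ℂ}
    (hh : IsKernel m (n + 1) (List.ofFn f) h) :
    HasIteratedOscillatoryIntegral χ n (fun z => wickSum m (shifted Θ f z))
      (twistedSum m Θ 0 n h) := by
  have key := hasIteratedOscillatoryIntegral_fourier hχ (quasiFreeGraphs (n + 1))
    (P := fun G => (G → Momentum)) (fun G => Measure.pi fun _ : G => shellMeasure m) n
    (fun G k q => minkTranspose Θ *ᵥ ∑ i ∈ Finset.range (k + 1), vertexMomentum m G q (0 + i))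
    (fun G k q => vertexMomentum m G q (0 + (k + 1))) (fun G k => by fun_prop)
    (fun G k => by fun_prop) h hh.1
  have hL : twistedSum m Θ 0 n h = ∑ G ∈ quasiFreeGraphs (n + 1), ∫ q, h G q
      * phase (∑ k : Fin n, mink (minkTranspose Θ *ᵥ
        ∑ i ∈ Finset.range (k + 1), vertexMomentum m G q (0 + i))
        (vertexMomentum m G q (0 + (k + 1)))) ∂(Measure.pi fun _ : G => shellMeasure m) := by
    simp only [twistedSum, twist, mink_minkTranspose, Finset.sum_range]
  have hF : ∀ z : Fin n → Spacetime × Spacetime, wickSum m (shifted Θ f z)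
      = ∑ G ∈ quasiFreeGraphs (n + 1), ∫ q, h G q
        * phase (∑ k : Fin n, (mink (minkTranspose Θ *ᵥ
          ∑ i ∈ Finset.range (k + 1), vertexMomentum m G q (0 + i)) (z k).1
          + mink (vertexMomentum m G q (0 + (k + 1))) (z k).2))
        ∂(Measure.pi fun _ : G => shellMeasure m) := by
    intro z
    set b : Fin (n + 1) → Spacetime := fun i =>
      Fin.cases (motive := fun _ => Spacetime) 0 (fun j => (z j).2) i
        + Θ *ᵥ ∑ k : Fin n with i ≤ k.castSucc, (z k).1
    have hsh : ∀ i, shifted Θ f z i = shiftFn (f i) (b i) := fun i => rfl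
    have hl : List.ofFn (shifted Θ f z) = (List.ofFn f).mapIdx fun i g =>
        shiftFn g (if hi : i < n + 1 then b ⟨i, hi⟩ else 0) :=
      List.ext_getElem (by simp) fun i h1 h2 => by
        have : i < n + 1 := by simpa using h1
        simp only [List.getElem_ofFn, List.getElem_mapIdx, hsh, dif_pos this]
    rw [← nPoint_eq_wickSum fun i => by rw [hsh]; exact (hf i).shift _, hl, hh.2]
    refine Finset.sum_congr rfl fun G _ => integral_congr_ae (ae_of_all _ fun q => ?_)
    simp only
    rw [Finset.sum_range]
    simp only [Fin.is_lt, dite_true, Fin.eta]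
    exact congrArg (fun t => h G q * phase t) (sum_mink_shifted (vertexMomentum m G q) Θ z)
  rw [hL]
  simp only [hF]
  exact key

end DeformedQFT

end

theorem mainTheorem7 (m : ℝ) (hm : 0 ≤ m) (n : ℕ)
    (f : Fin (n + 1) → DeformedQFT.Spacetime → ℂ)
    (hf : ∀ i, DeformedQFT.IsTestFunction (f i)) :
    ∃ W : Matrix (Fin 4) (Fin 4) ℝ → ℂ,
      (∀ χ, DeformedQFT.IsCutoff χ → ∀ Θ : Matrix (Fin 4) (Fin 4) ℝ,
        ∀ w : ℂ, DeformedQFT.IsDeformedNPoint m χ Θ n f w ↔ w = W Θ) ∧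
      (Odd (n + 1) → ∀ Θ : Matrix (Fin 4) (Fin 4) ℝ, W Θ = 0) ∧
      (Even (n + 1) → ∀ χ, DeformedQFT.IsCutoff χ → ∀ Θ : Matrix (Fin 4) (Fin 4) ℝ,
        DeformedQFT.HasIteratedOscillatoryIntegral χ n
          (fun z => DeformedQFT.wickSum m (DeformedQFT.shifted Θ f z)) (W Θ)) ∧
      Tendsto W (𝓝 0) (𝓝 (DeformedQFT.nPoint m (List.ofFn f))) := by
  have hk := DeformedQFT.isKernel_wickKernel m hf
  refine ⟨fun Θ => DeformedQFT.twistedSum m Θ 0 n (DeformedQFT.wickKernel m f),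
    fun χ hχ Θ w => ?_, fun hodd Θ => ?_, fun _ χ hχ Θ => ?_, ?_⟩
  · have hval : ∀ T, DeformedQFT.IsDeformedFieldProduct m χ Θ n f T →
        T DeformedQFT.vacuum DeformedQFT.vacuum
          = DeformedQFT.twistedSum m Θ 0 n (DeformedQFT.wickKernel m f) := fun T hT =>
      hT.hasTwistedElements hχ hf [] [] (by simp) (by simp) (n + 1) _ (by simp) (by simpa using hk)
    constructor
    · rintro ⟨T, hT, rfl⟩
      exact hval T hT
    · rintro rfl
      obtain ⟨T, hT⟩ := DeformedQFT.exists_isDeformedFieldProduct m hχ Θ hf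
      exact ⟨T, hT, hval T hT⟩
  · simp only [DeformedQFT.twistedSum]
    rw [DeformedQFT.quasiFreeGraphs_odd hodd, Finset.sum_empty]
  · exact DeformedQFT.hasIteratedOscillatoryIntegral_wickSum hχ Θ hf hk
  · rw [← DeformedQFT.twistedSum_zero hk 0 n]
    exact (DeformedQFT.continuous_twistedSum hk 0 n).tendsto 0
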